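/- Notation. Let $p$ be a prime, $d,k\in\mathbb{N}_{+}$. A quadratic form $M\colon\mathbb{F}_p^d\to\mathbb{F}_p$ is a function $M(n)=(nA)\cdot n+n\cdot u+v$ with $A$ a symmetric $d\times d$ matrix over $\mathbb{F}_p$, $u\in\mathbb{F}_p^d$, $v\in\mathbb{F}_p$; it is non-degenerate if $\det A\neq 0$. An $(M,k)$-integral quadratic function is a function on $(\mathbb{F}_p^d)^k$ of the form $F(n_1,\dots,n_k)=\sum_{1\le i\le j\le k}b_{i,j}(n_iA)\cdot n_j+\sum_{1\le i\le k}v_i\cdot n_i+u$ with $b_{i,j},u\in\mathbb{F}_p$ and $v_i\in\mathbb{F}_p^d$; its coefficient vector consists of all $b_{i,j}$, $v_i$ and $u$. It is nice if $F=\sum_{1\le i\le k'}b_i(n_{k'}A)\cdot n_i+u$ for some $0\le k'\le k$. A finite (possibly empty) family $F_1,\dots,F_r$ of such functions is consistent if the vector whose only non-zero entry is a $1$ in the constant-term position is not in the span of the coefficient vectors; independent if the coefficient vectors with the constant term deleted are linearly independent; nice if there are a bijection $L$ of $(\mathbb{F}_p^d)^k$ of the form $L(n_1,\dots,n_k)=(\sum_i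 a_{i,1}n_i,\dots,\sum_i a_{i,k}n_i)$, $a_{i,j}\in\mathbb{F}_p$, and $w\in(\mathbb{F}_p^d)^k$ such that every $F_i(L(\cdot)+w)$ is nice. An $M$-set $\Omega\subseteq(\mathbb{F}_p^d)^k$ is the common zero set of such a family; it is nice (respectively consistent) if the family can be chosen nice (respectively consistent). The total co-dimension $r_M(\Omega)$ of a consistent $M$-set is the least number of members of an independent family with common zero set $\Omega$. A set $\Omega\subseteq\mathbb{F}_p^N$ is $\delta$-irreducible up to degree $s$ if every polynomial $P\colon\mathbb{F}_p^N\to\mathbb{F}_p$ of degree at most $s$, with zero set $V(P)$, satisfies $|V(P)\cap\Omega|\le\delta|\Omega|$ or $\Omega\subseteq V(P)$. For a real polynomial $P$ on $\mathbb{Z}^N$ let $V_p(P)$ be the set of $n\in\mathbb{Z}^N$ with $P(n+pm)\in\mathbb{Z}$ for all $m\in\mathbb{Z}^N$, and for $\Omega\subseteq\mathbb{Z}^N$ let $\Omega':=(\Omega+p\mathbb{Z}^N)\cap\{0,\dots,p-1\}^N$. Then $\Omega$ is weakly (respectively strongly) $(\delta,p)$-irreducible up to degree $s$ if every polynomial $P$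 of degree at most $s$ that maps $\mathbb{Z}^N$ to $\frac1p\mathbb{Z}$ (respectively to $\frac1{p^s}\mathbb{Z}$) satisfies $|V_p(P)\cap\Omega'|\le\delta|\Omega'|$ or $\Omega'\subseteq V_p(P)$. Let $\tau\colon\mathbb{F}_p^N\to\{0,\dots,p-1\}^N\subseteq\mathbb{Z}^N$ be the natural coordinatewise embedding. Theorem (nice and consistent $M$-sets are irreducible). For all $d\in\mathbb{N}_{+}$ and $s\in\mathbb{N}$ there are constants $C_1,C_2>0$, depending only on $d$ and $s$, such that the following holds for every $K\in\mathbb{N}_{+}$, every prime $p$, every $\delta>0$, every non-degenerate quadratic form $M\colon\mathbb{F}_p^d\to\mathbb{F}_p$ and every nice and consistent $M$-set $\Omega\subseteq(\mathbb{F}_p^d)^K$. If $d\ge\max\{2r_M(\Omega)+1,4K-1\}$ and $p\ge C_1\delta^{-C_2}$, then (i) $\Omega$ is $\delta$-irreducible up to degree $s$; (ii) $\tau(\Omega)$ is weakly $(\delta,p)$-irreducible up to degree $s$; (iii) $\tau(\Omega)$ is strongly $(\delta,p)$-irreducible up to degree $s$. -/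

import Mathlib

open scoped Matrix

/-- A quadratic form on `𝔽_p^d` in the inhomogeneous sense: `M(n) = (nA)·n + n·u + v` with `A` a
symmetric matrix (the matrix associated to `M`), vectors being row vectors. -/
structure FpQuadForm (p d : ℕ) where
  A : Matrix (Fin d) (Fin d) (ZMod p)
  isSymm : A.IsSymm
  u : Fin d → ZMod p
  v : ZMod p

/-- The function `𝔽_p^d → 𝔽_p` given by a quadratic form. -/
def FpQuadForm.toFun {p d : ℕ} (M : FpQuadForm p d) (n : Fin d → ZMod p) : ZMod p :=
  (n ᵥ* M.A) ⬝ᵥ n + n ⬝ᵥ M.u + M.v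

/-- `M` is non-degenerate if its associated matrix is invertible. -/
def FpQuadForm.Nondegenerate {p d : ℕ} (M : FpQuadForm p d) : Prop :=
  M.A.det ≠ 0

/-- Points `(n_1, …, n_k)` of `(𝔽_p^d)^k`, identified with `𝔽_p^(kd)`: the coordinate `(i, l)` is
the `l`-th coordinate of `n_i`. -/
abbrev FpPoint (p d k : ℕ) : Type := Fin k × Fin d → ZMod p

/-- The `i`-th vector `n_i ∈ 𝔽_p^d` of a point of `(𝔽_p^d)^k`. -/
def FpPoint.block {p d k : ℕ} (n : FpPoint p d k) (i : Fin k) : Fin d → ZMod p :=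
  fun l => n (i, l)

/-- The coefficients `(b_{i,j})_{i ≤ j}`, `(v_i)_i` of the non-constant terms of an
`(M,k)`-integral quadratic function. -/
abbrev MCoeff' (p d k : ℕ) : Type :=
  ({q : Fin k × Fin k // q.1 ≤ q.2} → ZMod p) × (Fin k → Fin d → ZMod p)

/-- The full coefficient vector of an `(M,k)`-integral quadratic function: the coefficients
`(b_{i,j})_{i ≤ j}`, `(v_i)_i` together with the constant term `u`. -/
abbrev MCoeff (p d k : ℕ) : Type := MCoeff' p d k × ZMod p

/-- The `(M,k)`-integral quadratic function
`F(n_1, …, n_k) = ∑_{i ≤ j} b_{i,j} (n_i A)·n_j + ∑_i v_i·n_i + u` with given coefficients. -/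
def FpQuadForm.quadFun {p d k : ℕ} (M : FpQuadForm p d) (F : MCoeff p d k) (n : FpPoint p d k) :
    ZMod p :=
  (∑ q : {q : Fin k × Fin k // q.1 ≤ q.2},
      F.1.1 q * ((FpPoint.block n q.1.1 ᵥ* M.A) ⬝ᵥ FpPoint.block n q.1.2))
    + (∑ i : Fin k, F.1.2 i ⬝ᵥ FpPoint.block n i) + F.2

/-- The common zero set of an `(M,k)`-family `F_1, …, F_r` (`r = 0` is allowed and gives the whole
space). -/
def FpQuadForm.zeroSet {p d k r : ℕ} (M : FpQuadForm p d) (F : Fin r → MCoeff p d k) :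
    Set (FpPoint p d k) :=
  {n | ∀ i, M.quadFun (F i) n = 0}

/-- A function on `(𝔽_p^d)^k` is nice if it is of the form
`∑_{i ≤ k'} b_i (n_{k'} A)·n_i + u` for some `0 ≤ k' ≤ k` (constant for `k' = 0`). -/
def FpQuadForm.IsNiceFun {p d k : ℕ} (M : FpQuadForm p d) (f : FpPoint p d k → ZMod p) : Prop :=
  (∃ u : ZMod p, ∀ n, f n = u) ∨
  ∃ (k' : Fin k) (b : Fin k → ZMod p) (u : ZMod p), ∀ n : FpPoint p d k,
    f n = (∑ i ∈ Finset.univ.filter (fun i : Fin k => i ≤ k'),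
      b i * ((FpPoint.block n k' ᵥ* M.A) ⬝ᵥ FpPoint.block n i)) + u

/-- `L(n_1, …, n_k) = (∑_i a_{i,1} n_i, …, ∑_i a_{i,k} n_i)` for some scalars `a_{i,j}`. -/
def IsDIntegral {p d k : ℕ} (L : FpPoint p d k → FpPoint p d k) : Prop :=
  ∃ a : Fin k → Fin k → ZMod p, ∀ n j,
    FpPoint.block (L n) j = ∑ i : Fin k, a i j • FpPoint.block n i

/-- A family is nice if all its members become nice after one common bijective `d`-integral linear
change of variables and one common translation. -/
def FpQuadForm.IsNiceFamily {p d k r : ℕ} (M : FpQuadForm p d) (F : Fin r → MCoeff p d k) : Prop :=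
  ∃ L : FpPoint p d k → FpPoint p d k, IsDIntegral L ∧ Function.Bijective L ∧
    ∃ v : FpPoint p d k, ∀ i, M.IsNiceFun (fun n => M.quadFun (F i) (L n + v))

/-- A family is consistent if `(0, …, 0, 1)` is not in the span of the coefficient vectors. -/
def IsConsistentFamily {p d k r : ℕ} (F : Fin r → MCoeff p d k) : Prop :=
  ((0, 1) : MCoeff p d k) ∉ Submodule.span (ZMod p) (Set.range F)

/-- A family is independent if the vectors of non-constant coefficients are linearly independent. -/
def IsIndependentFamily {p d k r : ℕ} (F : Fin r → MCoeff p d k) : Prop :=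
  LinearIndependent (ZMod p) (fun i => (F i).1)

/-- `Ω` is a nice `M`-set: the zero set of some nice `(M,k)`-family. -/
def FpQuadForm.IsNiceSet {p d k : ℕ} (M : FpQuadForm p d) (Ω : Set (FpPoint p d k)) : Prop :=
  ∃ (r : ℕ) (F : Fin r → MCoeff p d k), M.IsNiceFamily F ∧ Ω = M.zeroSet F

/-- `Ω` is a consistent `M`-set: the zero set of some consistent `(M,k)`-family. -/
def FpQuadForm.IsConsistentSet {p d k : ℕ} (M : FpQuadForm p d) (Ω : Set (FpPoint p d k)) : Prop :=
  ∃ (r : ℕ) (F : Fin r → MCoeff p d k), IsConsistentFamily F ∧ Ω = M.zeroSet F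

/-- `Ω` is the zero set of an independent family with `r` members. -/
def FpQuadForm.HasIndependentRep {p d k : ℕ} (M : FpQuadForm p d) (Ω : Set (FpPoint p d k))
    (r : ℕ) : Prop :=
  ∃ F : Fin r → MCoeff p d k, IsIndependentFamily F ∧ Ω = M.zeroSet F

/-- The total co-dimension `r_M(Ω)` of a consistent `M`-set: the least size of an independent
family with zero set `Ω` (one exists, see `FpQuadForm.exists_hasIndependentRep`). -/
noncomputable def FpQuadForm.totalCodim {p d k : ℕ} (M : FpQuadForm p d)
    (Ω : Set (FpPoint p d k)) : ℕ :=
  sInf {r : ℕ | M.HasIndependentRep Ω r}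

lemma FpQuadForm.quadFun_add {p d k : ℕ} (M : FpQuadForm p d) (F G : MCoeff p d k)
    (n : FpPoint p d k) : M.quadFun (F + G) n = M.quadFun F n + M.quadFun G n := by
  simp only [FpQuadForm.quadFun, Prod.fst_add, Prod.snd_add, Pi.add_apply, add_mul,
    Finset.sum_add_distrib, add_dotProduct]
  ring

lemma FpQuadForm.quadFun_smul {p d k : ℕ} (M : FpQuadForm p d) (c : ZMod p) (F : MCoeff p d k)
    (n : FpPoint p d k) : M.quadFun (c • F) n = c * M.quadFun F n := by
  simp only [FpQuadForm.quadFun, Prod.smul_fst, Prod.smul_snd, Pi.smul_apply, smul_eq_mul,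
    mul_assoc, ← Finset.mul_sum, smul_dotProduct, mul_add]

lemma FpQuadForm.quadFun_eq_zero_of_mem_span {p d k : ℕ} (M : FpQuadForm p d)
    {S : Set (MCoeff p d k)} {n : FpPoint p d k} (hS : ∀ G ∈ S, M.quadFun G n = 0)
    {G : MCoeff p d k} (hG : G ∈ Submodule.span (ZMod p) S) : M.quadFun G n = 0 := by
  induction hG using Submodule.span_induction with
  | mem x hx => exact hS x hx
  | zero => simp [FpQuadForm.quadFun]
  | add x y _ _ hx hy => rw [FpQuadForm.quadFun_add, hx, hy, add_zero]
  | smul c x _ hx => rw [FpQuadForm.quadFun_smul, hx, mul_zero]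

/-- A consistent `M`-set has an independent representation, so that its total co-dimension is a
minimum over a non-empty set. -/
lemma FpQuadForm.exists_hasIndependentRep {p d k : ℕ} [Fact p.Prime] (M : FpQuadForm p d)
    {Ω : Set (FpPoint p d k)} (hΩ : M.IsConsistentSet Ω) : ∃ r, M.HasIndependentRep Ω r := by
  obtain ⟨r, F, hF, rfl⟩ := hΩ
  obtain ⟨κ, a, ha, hspan, hli⟩ := exists_linearIndependent' (ZMod p) (fun i => (F i).1)
  have : Finite κ := Finite.of_injective a ha
  obtain ⟨m, ⟨e⟩⟩ := Finite.exists_equiv_fin κ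
  refine ⟨m, fun i => F (a (e.symm i)), ?_, ?_⟩
  · exact hli.comp e.symm e.symm.injective
  · ext n
    refine ⟨fun h i => h _, fun h j => ?_⟩
    have hrange : Set.range (fun i => F (a (e.symm i))) = Set.range (F ∘ a) := by
      ext x
      simp only [Set.mem_range, Function.comp_apply]
      exact ⟨fun ⟨i, hi⟩ => ⟨_, hi⟩, fun ⟨i, hi⟩ => ⟨e i, by simpa using hi⟩⟩
    have hj : (F j).1 ∈ Submodule.span (ZMod p) (Set.range ((fun i => (F i).1) ∘ a)) := by
      rw [hspan]
      exact Submodule.subset_span ⟨j, rfl⟩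
    have himg : Set.range ((fun i => (F i).1) ∘ a)
        = (LinearMap.fst (ZMod p) (MCoeff' p d k) (ZMod p)) '' Set.range (F ∘ a) := by
      rw [← Set.range_comp]
      rfl
    rw [himg, Submodule.span_image] at hj
    obtain ⟨G, hG, hGj⟩ := hj
    have hGF : G ∈ Submodule.span (ZMod p) (Set.range F) :=
      Submodule.span_mono (Set.range_comp_subset_range a F) hG
    have hdiff : F j - G ∈ Submodule.span (ZMod p) (Set.range F) :=
      Submodule.sub_mem _ (Submodule.subset_span ⟨j, rfl⟩) hGF
    have h1 : (F j - G).1 = 0 := by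
      have : G.1 = (F j).1 := hGj
      simp [this]
    have h2 : (F j - G).2 = 0 := by
      by_contra hne
      apply hF
      have := Submodule.smul_mem _ ((F j - G).2)⁻¹ hdiff
      convert this using 1
      ext1
      · simp [h1]
      · exact (inv_mul_cancel₀ hne).symm
    have hFG : F j = G := sub_eq_zero.mp (Prod.ext h1 h2)
    rw [hFG]
    refine M.quadFun_eq_zero_of_mem_span (S := Set.range (F ∘ a)) ?_ hG
    rw [← hrange]
    rintro _ ⟨i, rfl⟩
    exact h i

/-- `Ω ⊆ 𝔽_p^ι` is `δ`-irreducible up to degree `s`: every polynomial of degree at most `s` either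
vanishes on at most a proportion `δ` of `Ω`, or vanishes on all of `Ω`. (Reducing the exponents of
a polynomial to at most `p - 1` changes neither the function nor the bound on the degree.) -/
def IsDeltaIrreducible {p : ℕ} {ι : Type*} (δ : ℝ) (s : ℕ) (Ω : Set (ι → ZMod p)) : Prop :=
  ∀ P : MvPolynomial ι (ZMod p), P.totalDegree ≤ s →
    ((({n | MvPolynomial.eval n P = 0} ∩ Ω).ncard : ℝ) ≤ δ * (Ω.ncard : ℝ)) ∨
      Ω ⊆ {n | MvPolynomial.eval n P = 0}

/-- The value of a real polynomial at an integer point. -/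
noncomputable def evalInt {ι : Type*} (P : MvPolynomial ι ℝ) (n : ι → ℤ) : ℝ :=
  MvPolynomial.eval (fun i => (n i : ℝ)) P

/-- `P` maps `ℤ^ι` to `ℤ/q = {z/q : z ∈ ℤ} ⊆ ℝ`. -/
def TakesValuesIn {ι : Type*} (q : ℕ) (P : MvPolynomial ι ℝ) : Prop :=
  ∀ n : ι → ℤ, ∃ z : ℤ, evalInt P n = (z : ℝ) / (q : ℝ)

/-- `V_p(P)`: the integer points `n` such that `P(n + pm) ∈ ℤ` for all `m ∈ ℤ^ι`. -/
def intZeroSet {ι : Type*} (p : ℕ) (P : MvPolynomial ι ℝ) : Set (ι → ℤ) :=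
  {n | ∀ m : ι → ℤ, ∃ z : ℤ, evalInt P (n + (p : ℤ) • m) = (z : ℝ)}

/-- `(Ω + pℤ^ι) ∩ {0, …, p-1}^ι`. -/
def reduceMod {ι : Type*} (p : ℕ) (Ω : Set (ι → ℤ)) : Set (ι → ℤ) :=
  {n | (∀ i, 0 ≤ n i ∧ n i < (p : ℤ)) ∧ ∃ m : ι → ℤ, n + (p : ℤ) • m ∈ Ω}

/-- `Ω ⊆ ℤ^ι` is weakly `(δ,p)`-irreducible up to degree `s`
(test polynomials of degree at most `s` with values in `ℤ/p`). -/
def IsWeaklyIrreducible {ι : Type*} (δ : ℝ) (p s : ℕ) (Ω : Set (ι → ℤ)) : Prop :=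
  ∀ P : MvPolynomial ι ℝ, P.totalDegree ≤ s → TakesValuesIn p P →
    (((intZeroSet p P ∩ reduceMod p Ω).ncard : ℝ) ≤ δ * ((reduceMod p Ω).ncard : ℝ)) ∨
      reduceMod p Ω ⊆ intZeroSet p P

/-- `Ω ⊆ ℤ^ι` is strongly `(δ,p)`-irreducible up to degree `s`
(test polynomials of degree at most `s` with values in `ℤ/p^s`). -/
def IsStronglyIrreducible {ι : Type*} (δ : ℝ) (p s : ℕ) (Ω : Set (ι → ℤ)) : Prop :=
  ∀ P : MvPolynomial ι ℝ, P.totalDegree ≤ s → TakesValuesIn (p ^ s) P →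
    (((intZeroSet p P ∩ reduceMod p Ω).ncard : ℝ) ≤ δ * ((reduceMod p Ω).ncard : ℝ)) ∨
      reduceMod p Ω ⊆ intZeroSet p P

/-- The natural embedding `τ` of `𝔽_p^ι` into `{0, …, p-1}^ι ⊆ ℤ^ι`. -/
def tauMap {p : ℕ} {ι : Type*} (x : ι → ZMod p) : ι → ℤ :=
  fun i => ((x i).val : ℤ)

/-!
Why the theorem holds. After an affine change of variables `T`, a nice `M`-set is the set `Z` of
all `x = (x_1, …, x_K)` whose Gram matrix `(x_i A) · x_j` satisfies some affine conditions
(`FpQuadForm.IsNiceFun.exists_coeff`); let `r` be the number of independent ones.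

*Charts.* Let `f_1, …, f_K` be a totally isotropic family. Where the matrix `a(x) = ((x_i A) · f_j)`
is invertible, any prescribed Gram matrix is reached from `x` by exactly one displacement
`x_i ↦ x_i + ∑ c_{i,j} f_j` with `c a(x)ᵀ` symmetric, and the displacement is a rational function of
bounded degree which leaves `a(x)` unchanged. Cancelling the conditions in this way retracts
the open set `det a ≠ 0` of affine space onto its intersection with `Z`, and all fibres have exactly
`p ^ r` points (`FpQuadForm.ncard_retract_preimage`). So a chart is a rational image of affine space
with uniform fibres, and the Schwartz–Zippel lemma shows that a polynomial with too many zeros in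
the chart vanishes on the whole chart (`FpQuadForm.chart_dichotomy`).

*A chart is almost everything.* By Weyl differencing, the exponential sums attached to `M`-quadratic
functions save `p ^ (d / 2)`, so that the zero set of an independent family of `r` members has
`p ^ (K d - r) (1 + O(p ^ (-1/2)))` points if `2 r < d`
(`FpQuadForm.Nondegenerate.abs_ncard_zeroSet_sub_le`). The same estimate shows that `r` is at most
the total co-dimension. As a chart has `p ^ (K d - r) (1 + O(1 / p))` points, a polynomial with a
positive proportion of zeros on `Z` vanishes on every chart.

*From the charts to all points.* For `x ∈ Z` choose a totally isotropic family `y_1, …, y_K`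
orthogonal to all `x_i`. The line `x + t y` stays in `Z`, and almost all of it lies in the chart
of a family `f` dual to `y`. Hence the polynomial vanishes at `x` (`mem_residueZeros_of_line`). Such
a `y` need not exist for `K = 1` and `x_1` non-isotropic, but then `x` itself lies in a chart
(`FpQuadForm.Nondegenerate.exists_line`).

*Integral polynomials.* All three parts are statements about integral polynomials `Q` and residue
classes all of whose representatives `z` satisfy `p ^ j ∣ Q(z)` (`IsResidueIrreducible`): real
polynomials with values in `ℤ / p ^ j` become integral after multiplication with `p ^ j` and an
integer prime to `p`. The arguments above work for these classes instead of zeros, because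
affine space has the required property for every `j`, with a bound independent of `j`: reduce modulo
`p`, use Schwartz–Zippel, divide by `p`, and repeat (`dvd_eval_of_lt_ncard_residueZeros`). The lifts
of a point of a chart are parametrised by adding `p` times a further vector of variables
(`rational_chart_dichotomy`).
-/

/-! ### Functions given by polynomials of bounded degree -/

/-- `g` is the function of a polynomial of total degree at most `D`. -/
def IsPolyFun {σ R : Type*} [CommRing R] (D : ℕ) (g : (σ → R) → R) : Prop :=
  ∃ P : MvPolynomial σ R, P.totalDegree ≤ D ∧ ∀ x, MvPolynomial.eval x P = g x

namespace IsPolyFun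

variable {σ R : Type*} [CommRing R] {D E : ℕ} {g h : (σ → R) → R}

lemma mono (hg : IsPolyFun D g) (hDE : D ≤ E) : IsPolyFun E g :=
  let ⟨P, hP, hx⟩ := hg
  ⟨P, hP.trans hDE, hx⟩

lemma const (c : R) : IsPolyFun D (fun _ : σ → R => c) :=
  ⟨MvPolynomial.C c, by simp, by simp⟩

lemma coord (i : σ) : IsPolyFun 1 (fun x : σ → R => x i) := by
  refine ⟨MvPolynomial.X i, ?_, by simp⟩
  cases subsingleton_or_nontrivial R
  · rw [Subsingleton.elim (MvPolynomial.X i : MvPolynomial σ R) 0]; simp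
  · simp

lemma add (hg : IsPolyFun D g) (hh : IsPolyFun D h) : IsPolyFun D (fun x => g x + h x) := by
  obtain ⟨P, hP, hx⟩ := hg
  obtain ⟨Q, hQ, hy⟩ := hh
  exact ⟨P + Q, (MvPolynomial.totalDegree_add P Q).trans (max_le hP hQ), by simp [hx, hy]⟩

lemma mul (hg : IsPolyFun D g) (hh : IsPolyFun E h) : IsPolyFun (D + E) (fun x => g x * h x) := by
  obtain ⟨P, hP, hx⟩ := hg
  obtain ⟨Q, hQ, hy⟩ := hh
  exact ⟨P * Q, (MvPolynomial.totalDegree_mul P Q).trans (add_le_add hP hQ), by simp [hx, hy]⟩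

lemma const_mul (c : R) (hg : IsPolyFun D g) : IsPolyFun D (fun x => c * g x) :=
  ((const (D := 0) c).mul hg).mono (by simp)

lemma mul_const (hg : IsPolyFun D g) (c : R) : IsPolyFun D (fun x => g x * c) := by
  simpa only [mul_comm] using hg.const_mul c

lemma sum {α : Type*} (s : Finset α) {f : α → (σ → R) → R} (hf : ∀ a ∈ s, IsPolyFun D (f a)) :
    IsPolyFun D (fun x => ∑ a ∈ s, f a x) := by
  induction s using Finset.cons_induction with
  | empty => simpa using const 0
  | cons a s ha ih =>
    simp only [Finset.sum_cons]
    exact (hf a (by simp)).add (ih fun b hb => hf b (by simp [hb]))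

lemma prod {α : Type*} (s : Finset α) {f : α → (σ → R) → R} (hf : ∀ a ∈ s, IsPolyFun D (f a)) :
    IsPolyFun (s.card * D) (fun x => ∏ a ∈ s, f a x) := by
  induction s using Finset.cons_induction with
  | empty => simpa using const 1
  | cons a s ha ih =>
    simp only [Finset.prod_cons, Finset.card_cons]
    exact ((hf a (by simp)).mul (ih fun b hb => hf b (by simp [hb]))).mono (by ring_nf; rfl)

lemma det {k : ℕ} {a : (σ → R) → Matrix (Fin k) (Fin k) R}
    (ha : ∀ i j, IsPolyFun 1 (fun x => a x i j)) : IsPolyFun k (fun x => (a x).det) := by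
  simp only [Matrix.det_apply']
  refine sum _ fun τ _ => const_mul _ ?_
  exact (prod Finset.univ fun i _ => ha (τ i) i).mono (by simp)

lemma adjugate {k : ℕ} {a : (σ → R) → Matrix (Fin k) (Fin k) R}
    (ha : ∀ i j, IsPolyFun 1 (fun x => a x i j)) (i j : Fin k) :
    IsPolyFun k (fun x => (a x).adjugate i j) := by
  simp only [Matrix.adjugate_apply]
  refine det fun l m => ?_
  by_cases hl : l = j
  · subst hl
    simpa using const _
  · simpa [Matrix.updateRow_ne hl] using ha l m

/-- A polynomial function over `𝔽_p` is the reduction of an integral one of the same degree. -/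
lemma exists_int_lift {p : ℕ} {g : (σ → ZMod p) → ZMod p} (hg : IsPolyFun D g) :
    ∃ P : MvPolynomial σ ℤ, P.totalDegree ≤ D ∧
      ∀ x : σ → ℤ, ((MvPolynomial.eval x P : ℤ) : ZMod p) = g (fun i => (x i : ZMod p)) := by
  classical
  obtain ⟨P, hP, hx⟩ := hg
  refine ⟨∑ m ∈ P.support, MvPolynomial.monomial m ((P.coeff m).cast : ℤ), ?_, fun x => ?_⟩
  · refine MvPolynomial.totalDegree_finsetSum_le fun m hm => ?_
    exact (MvPolynomial.totalDegree_monomial_le _ _).trans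
      ((MvPolynomial.le_totalDegree hm).trans hP)
  · rw [← hx, MvPolynomial.eval_eq (fun i => (x i : ZMod p)), map_sum]
    simp [MvPolynomial.eval_monomial, Finsupp.prod]

end IsPolyFun

/-! ### Zeros modulo prime powers -/

section ResidueZeros

variable {p : ℕ} {σ ι : Type*}

/-- The residue classes `n ∈ 𝔽_p^ι` all of whose integral representatives `z` satisfy
`q ∣ Q(z)`. -/
def residueZeros (p q : ℕ) (Q : MvPolynomial ι ℤ) : Set (ι → ZMod p) :=
  {n | ∀ z : ι → ℤ, (∀ i, (z i : ZMod p) = n i) → (q : ℤ) ∣ MvPolynomial.eval z Q}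

/-- The Schwartz–Zippel bound for the zeros in the whole of `𝔽_p^σ`. -/
lemma ncard_zeros_mul_le [Fact p.Prime] [Fintype σ] {P : MvPolynomial σ (ZMod p)} (hP : P ≠ 0) :
    {x | MvPolynomial.eval x P = 0}.ncard * p ≤ P.totalDegree * p ^ Fintype.card σ := by
  classical
  have hp : 0 < p := (Fact.out : p.Prime).pos
  set e := Fintype.equivFin σ
  set P' := MvPolynomial.rename e P
  have hP' : P' ≠ 0 := by
    rwa [Ne, MvPolynomial.rename_eq_zero_iff_of_injective _ e.injective]
  have hsz := MvPolynomial.schwartz_zippel_totalDegree hP' (Finset.univ : Finset (ZMod p))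
  have hdeg : P'.totalDegree ≤ P.totalDegree := MvPolynomial.totalDegree_rename_le _ _
  have hcard : {x | MvPolynomial.eval x P = 0}.ncard =
      (Finset.filter (fun f => MvPolynomial.eval f P' = 0)
        (Fintype.piFinset fun _ : Fin (Fintype.card σ) => (Finset.univ : Finset (ZMod p)))).card := by
    rw [← Set.ncard_coe_finset]
    refine Set.ncard_congr (fun x _ => x ∘ e.symm) ?_ ?_ ?_
    · intro x hx
      simpa [P', MvPolynomial.eval_rename, Function.comp_assoc] using hx
    · intro x y _ _ h
      funext i
      simpa using congrFun h (e i)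
    · intro y hy
      refine ⟨y ∘ e, ?_, by funext i; simp⟩
      simpa [P', MvPolynomial.eval_rename] using hy
  rw [hcard]
  rw [div_le_div_iff₀ (by simpa using pow_pos (by exact_mod_cast hp) _)
    (by simpa using hp)] at hsz
  simp only [Finset.card_univ, ZMod.card] at hsz
  have h2 := hsz.trans (mul_le_mul_of_nonneg_right (Nat.cast_le.2 hdeg) zero_le)
  exact_mod_cast h2

/-- Strong irreducibility of affine space: a polynomial divisible by `p ^ j` on all representatives
of many residue classes is divisible by `p ^ j` everywhere. At each step the reduction modulo `p`
has too many zeros, so that a factor `p` splits off. -/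
lemma dvd_eval_of_lt_ncard_residueZeros [Fact p.Prime] [Fintype σ] {D : ℕ} (j : ℕ)
    {H : MvPolynomial σ ℤ} (hD : H.totalDegree ≤ D)
    (hcard : D * p ^ Fintype.card σ < (residueZeros p (p ^ j) H).ncard * p) (x : σ → ℤ) :
    ((p ^ j : ℕ) : ℤ) ∣ MvPolynomial.eval x H := by
  have hp := (Fact.out : p.Prime)
  induction j generalizing H x with
  | zero => simp
  | succ j ih =>
    have hmap : MvPolynomial.map (Int.castRingHom (ZMod p)) H = 0 := by
      by_contra hne
      have h1 := ncard_zeros_mul_le hne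
      have h2 : (MvPolynomial.map (Int.castRingHom (ZMod p)) H).totalDegree ≤ D :=
        (Finset.sup_mono (MvPolynomial.support_map_subset _ _)).trans hD
      have h3 : residueZeros p (p ^ (j + 1)) H ⊆
          {x | MvPolynomial.eval x (MvPolynomial.map (Int.castRingHom (ZMod p)) H) = 0} := by
        intro n hn
        have h4 := hn (fun i => ((n i).cast : ℤ)) (fun i => by simp)
        have h5 : (p : ℤ) ∣ MvPolynomial.eval (fun i => ((n i).cast : ℤ)) H :=
          (by exact_mod_cast dvd_pow_self p (Nat.succ_ne_zero j) :
            (p : ℤ) ∣ ((p ^ (j + 1) : ℕ) : ℤ)).trans h4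
        rw [← ZMod.intCast_zmod_eq_zero_iff_dvd] at h5
        rw [Set.mem_ofPred_eq, MvPolynomial.eval_map, ← h5, ← eq_intCast (Int.castRingHom (ZMod p)),
          MvPolynomial.eval, MvPolynomial.coe_eval₂Hom, MvPolynomial.hom_eval₂]
        simp
      have h6 := Set.ncard_le_ncard h3 (Set.toFinite _)
      have h7 := (Nat.mul_le_mul_right p h6).trans (h1.trans (Nat.mul_le_mul_right _ h2))
      omega
    obtain ⟨H₁, rfl⟩ := (MvPolynomial.C_dvd_iff_zmod p H).2 hmap
    have hset : residueZeros p (p ^ (j + 1)) (MvPolynomial.C (p : ℤ) * H₁) ⊆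
        residueZeros p (p ^ j) H₁ := by
      intro n hn z hz
      have := hn z hz
      simp only [map_mul, MvPolynomial.eval_C, pow_succ', Nat.cast_mul] at this
      exact (mul_dvd_mul_iff_left (by exact_mod_cast hp.ne_zero)).1 this
    have hdeg : H₁.totalDegree ≤ D := by
      rcases eq_or_ne H₁ 0 with rfl | hne
      · simp
      rw [MvPolynomial.totalDegree_mul_of_isDomain
        (by simpa using hp.ne_zero) hne] at hD
      omega
    have h8 := ih hdeg (hcard.trans_le
      (Nat.mul_le_mul_right p (Set.ncard_le_ncard hset (Set.toFinite _)))) x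
    simp only [map_mul, MvPolynomial.eval_C, pow_succ', Nat.cast_mul]
    exact mul_dvd_mul_left _ h8

/-- The homogenisation trick: if `Q` has degree at most `s`, then `Δ ^ s * Q (c / Δ)` is a
polynomial in `Δ` and `c`. The division is expressed after a ring homomorphism `φ`, which is going
to be reduction modulo a prime power. -/
lemma exists_homogenization {R : Type*} [CommRing R] [Fintype ι] {s D₀ : ℕ}
    (Q : MvPolynomial ι R) (hQ : Q.totalDegree ≤ s) {Δ : (σ → R) → R} {c : ι → (σ → R) → R}
    (hΔ : IsPolyFun D₀ Δ) (hc : ∀ i, IsPolyFun (D₀ + 1) (c i)) :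
    ∃ H : MvPolynomial σ R, H.totalDegree ≤ s * (D₀ + 1) ∧
      ∀ {S : Type*} [CommRing S] (φ : R →+* S) x (z : ι → R), (∀ i, φ (c i x) = φ (Δ x * z i)) →
        φ (MvPolynomial.eval x H) = φ (Δ x ^ s * MvPolynomial.eval z Q) := by
  classical
  have hpow : ∀ (n : ℕ) {D : ℕ} {g : (σ → R) → R}, IsPolyFun D g →
      IsPolyFun (n * D) (fun x => g x ^ n) := fun n D g hg => by
    simpa using IsPolyFun.prod (Finset.range n) (f := fun _ => g) (fun _ _ => hg)
  have hdeg : ∀ m ∈ Q.support, ∑ i, m i ≤ s := fun m hm => by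
    have := (MvPolynomial.le_totalDegree hm).trans hQ
    rwa [Finsupp.sum_fintype _ _ (fun _ => rfl)] at this
  have hprod : ∀ m : ι →₀ ℕ, IsPolyFun ((∑ i, m i) * (D₀ + 1)) (fun x => ∏ i, c i x ^ m i) := by
    intro m
    have : ∀ t : Finset ι, IsPolyFun ((∑ i ∈ t, m i) * (D₀ + 1))
        (fun x => ∏ i ∈ t, c i x ^ m i) := by
      intro t
      induction t using Finset.cons_induction with
      | empty => simpa using IsPolyFun.const 1
      | cons a t ha ih =>
        simp only [Finset.prod_cons, Finset.sum_cons, add_mul]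
        exact (hpow _ (hc a)).mul ih
    exact this Finset.univ
  obtain ⟨H, hH, hHx⟩ : IsPolyFun (s * (D₀ + 1)) (fun x => ∑ m ∈ Q.support,
      Q.coeff m * (Δ x ^ (s - ∑ i, m i) * ∏ i, c i x ^ m i)) := by
    refine IsPolyFun.sum _ fun m hm => IsPolyFun.const_mul _ ?_
    refine ((hpow _ hΔ).mul (hprod m)).mono ?_
    have h := hdeg m hm
    calc (s - ∑ i, m i) * D₀ + (∑ i, m i) * (D₀ + 1)
        ≤ (s - ∑ i, m i) * (D₀ + 1) + (∑ i, m i) * (D₀ + 1) := by gcongr; omega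
      _ = s * (D₀ + 1) := by rw [← add_mul, Nat.sub_add_cancel h]
  refine ⟨H, hH, fun φ x z hz => ?_⟩
  rw [hHx, MvPolynomial.eval_eq', Finset.mul_sum, map_sum, map_sum]
  refine Finset.sum_congr rfl fun m hm => ?_
  simp only [map_mul, map_prod, map_pow, hz, mul_pow, Finset.prod_mul_distrib,
    Finset.prod_pow_eq_pow_sum]
  calc _ = φ (Q.coeff m) * ((φ (Δ x) ^ (s - ∑ i, m i) * φ (Δ x) ^ (∑ i, m i)) *
        ∏ i, φ (z i) ^ m i) := by ring
    _ = _ := by rw [← pow_add, Nat.sub_add_cancel (hdeg m hm)]; ring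

/-- A rational chart spreads zeros: let `Ψ = C / Δ` be a rational map of bounded degree from
`𝔽_p^σ` to `𝔽_p^ι`. If `Ψ` maps many points into `residueZeros p (p ^ j) Q`, it maps all points
there. The representatives of `Ψ(x)` are the `C(x) / Δ(x) + p y`, so that affine space of dimension
`|σ| + |ι|` with the polynomial `Δ ^ s * Q (C / Δ + p y)` replaces the chart. -/
lemma rational_chart_dichotomy [Fact p.Prime] [Fintype σ] [Fintype ι] {s D₀ : ℕ} (j : ℕ)
    {Q : MvPolynomial ι ℤ} (hQ : Q.totalDegree ≤ s) {Δ : (σ → ZMod p) → ZMod p}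
    {C : ι → (σ → ZMod p) → ZMod p} (hΔ : IsPolyFun D₀ Δ) (hC : ∀ i, IsPolyFun D₀ (C i)) :
    {x | Δ x ≠ 0 ∧ (fun i => C i x / Δ x) ∈ residueZeros p (p ^ j) Q}.ncard * p ≤
        s * (D₀ + 1) * p ^ Fintype.card σ ∨
      ∀ x, Δ x ≠ 0 → (fun i => C i x / Δ x) ∈ residueZeros p (p ^ j) Q := by
  classical
  have hp := (Fact.out : p.Prime)
  obtain ⟨Δ', hΔ', hΔx⟩ := hΔ.exists_int_lift
  choose C' hC' hCx using fun i => (hC i).exists_int_lift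
  have liftl : ∀ {D : ℕ} (P : MvPolynomial σ ℤ), P.totalDegree ≤ D →
      IsPolyFun D (fun w : σ ⊕ ι → ℤ => MvPolynomial.eval (w ∘ Sum.inl) P) := fun P hP =>
    ⟨MvPolynomial.rename Sum.inl P, (MvPolynomial.totalDegree_rename_le _ _).trans hP,
      fun x => by rw [MvPolynomial.eval_rename]⟩
  obtain ⟨H, hH, hHx⟩ := exists_homogenization Q hQ (liftl Δ' hΔ')
    (c := fun i w => MvPolynomial.eval (w ∘ Sum.inl) (C' i) +
      p * (MvPolynomial.eval (w ∘ Sum.inl) Δ' * w (Sum.inr i)))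
    (fun i => ((liftl (C' i) (hC' i)).mono (Nat.le_succ _)).add
      (((liftl Δ' hΔ').mul (IsPolyFun.coord _)).const_mul _))
  -- `p ^ j ∣ H (x, y)` says the same as `p ^ j ∣ Q (z)` for the representative
  -- `z = e * C(x) + p * y` of `Ψ(x)`, where `e` is an inverse of `Δ(x)` modulo `p ^ j`
  have key : ∀ (w : σ ⊕ ι → ℤ) (e : ℤ),
      ((p ^ j : ℕ) : ℤ) ∣ e * MvPolynomial.eval (w ∘ Sum.inl) Δ' - 1 →
      (((p ^ j : ℕ) : ℤ) ∣ MvPolynomial.eval w H ↔ ((p ^ j : ℕ) : ℤ) ∣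
        MvPolynomial.eval (fun i => e * MvPolynomial.eval (w ∘ Sum.inl) (C' i) +
          p * w (Sum.inr i)) Q) := by
    intro w e he
    rw [← ZMod.intCast_zmod_eq_zero_iff_dvd, ← ZMod.intCast_zmod_eq_zero_iff_dvd] at *
    have he' : (e : ZMod (p ^ j)) * (MvPolynomial.eval (w ∘ Sum.inl) Δ' : ℤ) = 1 := by
      simpa [sub_eq_zero] using he
    have h := hHx (Int.castRingHom (ZMod (p ^ j))) w
      (fun i => e * MvPolynomial.eval (w ∘ Sum.inl) (C' i) + p * w (Sum.inr i)) (fun i => by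
        simp only [eq_intCast, Int.cast_add, Int.cast_mul, Int.cast_natCast]
        linear_combination -((MvPolynomial.eval (w ∘ Sum.inl) (C' i) : ℤ) : ZMod (p ^ j)) * he')
    simp only [eq_intCast, Int.cast_mul, Int.cast_pow] at h
    rw [h]
    exact (IsUnit.pow s (IsUnit.of_mul_eq_one_right _ he')).mul_right_eq_zero
  have hinv : ∀ a : ℤ, (a : ZMod p) ≠ 0 → ∃ e : ℤ, ((p ^ (j + 1) : ℕ) : ℤ) ∣ e * a - 1 := by
    intro a ha
    have hcop : IsCoprime a ((p ^ (j + 1) : ℕ) : ℤ) := by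
      rw [Nat.cast_pow]
      refine IsCoprime.pow_right ((Prime.coprime_iff_not_dvd (Nat.prime_iff_prime_int.1 hp)).2
        ?_).symm
      rwa [← ZMod.intCast_zmod_eq_zero_iff_dvd]
    obtain ⟨u, v, huv⟩ := hcop
    exact ⟨u, -v, by linear_combination huv⟩
  have hlift : ∀ (x : σ → ℤ) (e : ℤ), ((p ^ (j + 1) : ℕ) : ℤ) ∣ e * MvPolynomial.eval x Δ' - 1 →
      ((p ^ j : ℕ) : ℤ) ∣ e * MvPolynomial.eval x Δ' - 1 ∧
      ∀ i, ((e * MvPolynomial.eval x (C' i) : ℤ) : ZMod p) =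
        C i (fun i => (x i : ZMod p)) / Δ (fun i => (x i : ZMod p)) := by
    intro x e he
    refine ⟨((by exact_mod_cast pow_dvd_pow p (Nat.le_succ j) :
      ((p ^ j : ℕ) : ℤ) ∣ ((p ^ (j + 1) : ℕ) : ℤ))).trans he, fun i => ?_⟩
    have h1 : (p : ℤ) ∣ e * MvPolynomial.eval x Δ' - 1 :=
      ((by exact_mod_cast dvd_pow_self p (Nat.succ_ne_zero j) :
        (p : ℤ) ∣ ((p ^ (j + 1) : ℕ) : ℤ))).trans he
    rw [← ZMod.intCast_zmod_eq_zero_iff_dvd] at h1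
    have h2 : (e : ZMod p) * Δ (fun i => (x i : ZMod p)) = 1 := by
      simpa [sub_eq_zero, hΔx] using h1
    rw [eq_div_iff (right_ne_zero_of_mul_eq_one h2)]
    simp only [Int.cast_mul, hCx]
    linear_combination C i (fun i => (x i : ZMod p)) * h2
  rw [or_iff_not_imp_left, not_le]
  intro hlarge
  have hHall : ∀ w, ((p ^ j : ℕ) : ℤ) ∣ MvPolynomial.eval w H := by
    refine dvd_eval_of_lt_ncard_residueZeros j hH ?_
    set A := {x | Δ x ≠ 0 ∧ (fun i => C i x / Δ x) ∈ residueZeros p (p ^ j) Q}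
    have hsub : A.ncard * p ^ Fintype.card ι ≤ (residueZeros p (p ^ j) H).ncard := by
      have h1 : (A ×ˢ (Set.univ : Set (ι → ZMod p))).ncard = A.ncard * p ^ Fintype.card ι := by
        rw [Set.ncard_prod, Set.ncard_univ, Nat.card_eq_fintype_card, Fintype.card_fun, ZMod.card]
      rw [← h1]
      refine Set.ncard_le_ncard_of_injOn (fun w => Sum.elim w.1 w.2) ?_ ?_ (Set.toFinite _)
      · rintro ⟨x, y⟩ ⟨⟨hx, hxQ⟩, -⟩ w hw
        have hwx : (fun i => (((w ∘ Sum.inl) i : ℤ) : ZMod p)) = x :=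
          funext fun i => by simpa using hw (Sum.inl i)
        obtain ⟨e, he⟩ := hinv (MvPolynomial.eval (w ∘ Sum.inl) Δ') (by rwa [hΔx, hwx])
        obtain ⟨h1, h2⟩ := hlift _ e he
        rw [key w e h1]
        refine hxQ _ fun i => ?_
        have := h2 i
        rw [hwx] at this
        simpa using this
      · rintro ⟨x, y⟩ - ⟨x', y'⟩ - h
        exact Prod.ext (by simpa using congrArg (fun f => f ∘ Sum.inl) h)
          (by simpa using congrArg (fun f => f ∘ Sum.inr) h)
    rw [Fintype.card_sum, pow_add]
    calc _ = s * (D₀ + 1) * p ^ Fintype.card σ * p ^ Fintype.card ι := by ring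
      _ < A.ncard * p * p ^ Fintype.card ι :=
        Nat.mul_lt_mul_of_pos_right hlarge (pow_pos hp.pos _)
      _ = A.ncard * p ^ Fintype.card ι * p := by ring
      _ ≤ _ := Nat.mul_le_mul_right p hsub
  intro x hx z hz
  set x' : σ → ℤ := fun i => ((x i).cast : ℤ)
  have hxx : (fun i => ((x' i : ℤ) : ZMod p)) = x := funext fun i => by simp [x']
  obtain ⟨e, he⟩ := hinv (MvPolynomial.eval x' Δ') (by rwa [hΔx, hxx])
  obtain ⟨h1, h2⟩ := hlift _ e he
  have h3 : ∀ i, ∃ y : ℤ, z i = e * MvPolynomial.eval x' (C' i) + p * y := by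
    intro i
    have h4 : ((z i - e * MvPolynomial.eval x' (C' i) : ℤ) : ZMod p) = 0 := by
      rw [Int.cast_sub, hz i, h2 i, hxx, sub_self]
    obtain ⟨y, hy⟩ := (ZMod.intCast_zmod_eq_zero_iff_dvd _ _).1 h4
    exact ⟨y, by linear_combination hy⟩
  choose y hy using h3
  have h5 := (key (Sum.elim x' y) e (by simpa using h1)).1 (hHall _)
  rw [funext hy]
  simpa using h5

/-- If a line through `n` has more than `s` points, counted by their parameters, in
`residueZeros p (p ^ j) Q`, then it contains `n` as well: interpolate on representatives, where the
denominators are prime to `p`. -/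
lemma mem_residueZeros_of_line [Fact p.Prime] [Fintype ι] {s : ℕ} (j : ℕ)
    {Q : MvPolynomial ι ℤ} (hQ : Q.totalDegree ≤ s) (n y : ι → ZMod p)
    (T : Finset (ZMod p)) (hT : s < T.card)
    (hline : ∀ t ∈ T, n + t • y ∈ residueZeros p (p ^ j) Q) : n ∈ residueZeros p (p ^ j) Q := by
  classical
  intro z hz
  set y' : ι → ℤ := fun i => ((y i).cast : ℤ)
  obtain ⟨H, hH, hHx⟩ := exists_homogenization (σ := Unit) (D₀ := 0) Q hQ
    (Δ := fun _ => 1) (c := fun i w => z i + w () * y' i) (IsPolyFun.const 1)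
    (fun i => (IsPolyFun.const _).add (by
      simpa [mul_comm] using (IsPolyFun.coord (R := ℤ) ()).const_mul (y' i)))
  have hHe : ∀ w : Unit → ℤ,
      MvPolynomial.eval w H = MvPolynomial.eval (fun i => z i + w () * y' i) Q := fun w => by
    simpa using hHx (RingHom.id ℤ) w (fun i => z i + w () * y' i) (fun i => by simp)
  have h0 := dvd_eval_of_lt_ncard_residueZeros (p := p) j hH ?_ (fun _ => 0)
  · rw [hHe] at h0
    simpa using h0
  have hsub : T.card ≤ (residueZeros p (p ^ j) H).ncard := by
    rw [← Set.ncard_coe_finset]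
    refine Set.ncard_le_ncard_of_injOn (fun t _ => t) ?_ ?_ (Set.toFinite _)
    · intro t ht w hw
      rw [hHe]
      refine hline t ht _ fun i => ?_
      simp [hz, hw (), y']
    · intro t _ t' _ h
      exact congrFun h ()
  simpa using Nat.mul_lt_mul_of_pos_right (hT.trans_le hsub) (Fact.out : p.Prime).pos

end ResidueZeros

/-! ### Integer-valued polynomials and the three notions of irreducibility -/

section Reduction

variable {p : ℕ} {ι : Type*}

/-- A real polynomial of degree at most `s` with integer values becomes integral after
multiplication with a product of non-zero integers of absolute value at most `s`, by Lagrange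
interpolation on the grid `{0, …, s} ^ ι`. -/
lemma exists_int_multiple [Fintype ι] (hp : p.Prime) {s : ℕ} (hs : s < p) (P : MvPolynomial ι ℝ)
    (hdeg : P.totalDegree ≤ s) (f : (ι → ℤ) → ℤ) (hf : ∀ n, evalInt P n = f n) :
    ∃ (R : ℤ) (Q : MvPolynomial ι ℤ), ¬ (p : ℤ) ∣ R ∧ Q.totalDegree ≤ s ∧
      ∀ n, MvPolynomial.eval n Q = R * f n := by
  classical
  set w : ℕ → ℤ := fun a => ∏ u ∈ (Finset.range (s + 1)).erase a, ((a : ℤ) - u)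
  set R₀ : ℤ := ∏ a ∈ Finset.range (s + 1), w a
  have hR₀ : ¬ (p : ℤ) ∣ R₀ := by
    have hpi := Nat.prime_iff_prime_int.1 hp
    intro h
    obtain ⟨a, ha, h⟩ := (hpi.dvd_finsetProd_iff _).1 h
    obtain ⟨u, hu, h⟩ := (hpi.dvd_finsetProd_iff _).1 h
    simp only [Finset.mem_range, Finset.mem_erase] at ha hu
    have h1 := Int.eq_zero_of_abs_lt_dvd h (by rw [abs_lt]; constructor <;> omega)
    omega
  -- the Lagrange basis polynomial at the node `a`, multiplied by `R₀`
  set L : ℕ → ι → MvPolynomial ι ℤ := fun a i =>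
    MvPolynomial.C (∏ b ∈ (Finset.range (s + 1)).erase a, w b) *
      ∏ u ∈ (Finset.range (s + 1)).erase a, (MvPolynomial.X i - MvPolynomial.C (u : ℤ))
  have hL : ∀ a ∈ Finset.range (s + 1), ∀ b ∈ Finset.range (s + 1), ∀ (i : ι) (n : ι → ℤ),
      n i = b → MvPolynomial.eval n (L a i) = if a = b then R₀ else 0 := by
    intro a ha b hb i n hn
    simp only [L, map_mul, MvPolynomial.eval_C, map_prod, map_sub, MvPolynomial.eval_X, hn]
    split_ifs with hab
    · subst hab
      exact Finset.prod_erase_mul _ w ha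
    · rw [mul_eq_zero]
      refine Or.inr (Finset.prod_eq_zero (i := b) ?_ (sub_self _))
      exact Finset.mem_erase.2 ⟨Ne.symm hab, hb⟩
  set Q : MvPolynomial ι ℤ := ∑ v ∈ Fintype.piFinset (fun _ : ι => Finset.range (s + 1)),
    MvPolynomial.C (f (fun i => (v i : ℤ))) * ∏ i, L (v i) i with hQ
  set R : ℤ := R₀ ^ Fintype.card ι
  have hQv : ∀ v ∈ Fintype.piFinset (fun _ : ι => Finset.range (s + 1)),
      MvPolynomial.eval (fun i => (v i : ℤ)) Q = R * f (fun i => (v i : ℤ)) := by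
    intro v hv
    rw [hQ, map_sum, Finset.sum_eq_single_of_mem v hv]
    · rw [map_mul, map_prod, Finset.prod_congr rfl (fun i _ => hL (v i)
        (Fintype.mem_piFinset.1 hv i) (v i) (Fintype.mem_piFinset.1 hv i) i _ rfl)]
      simp [R, mul_comm]
    · intro u hu huv
      obtain ⟨i, hi⟩ := Function.ne_iff.1 huv
      rw [map_mul, map_prod, Finset.prod_eq_zero (Finset.mem_univ i), mul_zero]
      rw [hL (u i) (Fintype.mem_piFinset.1 hu i) (v i) (Fintype.mem_piFinset.1 hv i) i _ rfl,
        if_neg hi]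
  have hLdeg : ∀ a ∈ Finset.range (s + 1), ∀ i k : ι,
      (L a i).degreeOf k ≤ if i = k then s else 0 := by
    intro a ha i k
    refine (MvPolynomial.degreeOf_C_mul_le _ _ _).trans ?_
    refine (MvPolynomial.degreeOf_prod_le _ _ _).trans ?_
    have h1 : ∀ u ∈ (Finset.range (s + 1)).erase a,
        (MvPolynomial.X i - MvPolynomial.C (u : ℤ) : MvPolynomial ι ℤ).degreeOf k ≤
          if i = k then 1 else 0 := fun u _ => by
      refine (MvPolynomial.degreeOf_sub_le _ _ _).trans ?_
      rw [MvPolynomial.degreeOf_C, MvPolynomial.degreeOf_X]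
      simp [eq_comm]
    refine (Finset.sum_le_sum h1).trans ?_
    split_ifs <;> simp [Finset.card_erase_of_mem ha]
  have hQdeg : ∀ k, Q.degreeOf k ≤ s := by
    intro k
    refine (MvPolynomial.degreeOf_sum_le _ _ _).trans (Finset.sup_le fun v hv => ?_)
    refine (MvPolynomial.degreeOf_C_mul_le _ _ _).trans ?_
    refine (MvPolynomial.degreeOf_prod_le _ _ _).trans ?_
    refine (Finset.sum_le_sum fun i _ => hLdeg (v i) (Fintype.mem_piFinset.1 hv i) i k).trans ?_
    simp
  have heval : ∀ n : ι → ℤ, MvPolynomial.eval (fun i => (Int.castRingHom ℝ) (n i))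
      (MvPolynomial.map (Int.castRingHom ℝ) Q) = (Int.castRingHom ℝ) (MvPolynomial.eval n Q) := by
    intro n
    rw [MvPolynomial.eval_map, MvPolynomial.eval, MvPolynomial.coe_eval₂Hom, MvPolynomial.hom_eval₂]
    rfl
  have hmap : MvPolynomial.map (Int.castRingHom ℝ) Q = MvPolynomial.C (R : ℝ) * P := by
    rw [← sub_eq_zero]
    refine MvPolynomial.eq_zero_of_eval_zero_at_prod_finset _
      (fun _ => (Finset.range (s + 1)).image (fun u : ℕ => (u : ℝ))) (fun i => ?_) (fun x hx => ?_)
    · rw [Finset.card_image_of_injective _ Nat.cast_injective, Finset.card_range, Nat.lt_succ_iff]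
      refine (MvPolynomial.degreeOf_sub_le _ _ _).trans (max_le ?_ ?_)
      · refine le_trans ?_ (hQdeg i)
        rw [MvPolynomial.degreeOf_eq_sup, MvPolynomial.degreeOf_eq_sup]
        exact Finset.sup_mono (MvPolynomial.support_map_subset _ _)
      · exact (MvPolynomial.degreeOf_C_mul_le _ _ _).trans
          ((MvPolynomial.degreeOf_le_totalDegree _ _).trans hdeg)
    · simp only [Finset.mem_image] at hx
      choose v hv hvx using hx
      have h1 := hQv v (Fintype.mem_piFinset.2 hv)
      have h2 := hf (fun i => (v i : ℤ))
      have hx' : x = fun i => (Int.castRingHom ℝ) (v i : ℤ) := funext fun i => by simp [← hvx]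
      rw [map_sub, map_mul, MvPolynomial.eval_C, sub_eq_zero, hx', heval, h1]
      simp only [evalInt] at h2
      simp [← h2]
  refine ⟨R, Q, ?_, ?_, fun n => ?_⟩
  · exact fun h => hR₀ ((Nat.prime_iff_prime_int.1 hp).dvd_of_dvd_pow h)
  · have h1 : (MvPolynomial.map (Int.castRingHom ℝ) Q).totalDegree = Q.totalDegree := by
      rw [MvPolynomial.totalDegree, MvPolynomial.totalDegree,
        MvPolynomial.support_map_of_injective _ (RingHom.injective_int _)]
    rw [← h1, hmap]
    refine (MvPolynomial.totalDegree_mul _ _).trans ?_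
    rwa [MvPolynomial.totalDegree_C, zero_add]
  · have h1 := congrArg (MvPolynomial.eval (fun i => (Int.castRingHom ℝ) (n i))) hmap
    rw [heval, map_mul, MvPolynomial.eval_C] at h1
    have h2 := hf n
    simp only [evalInt] at h2
    simp only [eq_intCast, h2] at h1
    exact_mod_cast h1

/-- The set `V_p(P)` is a union of residue classes, cut out by divisibility conditions on an
integral polynomial. -/
lemma exists_intZeroSet_eq [Fact p.Prime] [Fintype ι] {s j : ℕ} (hs : s < p)
    (P : MvPolynomial ι ℝ) (hdeg : P.totalDegree ≤ s) (hP : TakesValuesIn (p ^ j) P) :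
    ∃ Q : MvPolynomial ι ℤ, Q.totalDegree ≤ s ∧ ∀ n : ι → ℤ,
      n ∈ intZeroSet p P ↔ (fun i => (n i : ZMod p)) ∈ residueZeros p (p ^ j) Q := by
  have hp := (Fact.out : p.Prime)
  have hq : ((p ^ j : ℕ) : ℝ) ≠ 0 := by exact_mod_cast pow_ne_zero j hp.ne_zero
  choose f hf using hP
  obtain ⟨R, Q, hR, hQ, hQf⟩ := exists_int_multiple hp hs
    (MvPolynomial.C ((p ^ j : ℕ) : ℝ) * P)
    ((MvPolynomial.totalDegree_mul _ _).trans (by rwa [MvPolynomial.totalDegree_C, zero_add])) f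
    (fun n => by
      have := hf n
      simp only [evalInt] at this ⊢
      rw [map_mul, MvPolynomial.eval_C, this]
      field_simp)
  have hcop : IsCoprime ((p ^ j : ℕ) : ℤ) R := by
    rw [Nat.cast_pow]
    exact IsCoprime.pow_left ((Prime.coprime_iff_not_dvd (Nat.prime_iff_prime_int.1 hp)).2 hR)
  have key : ∀ n, (∃ z : ℤ, evalInt P n = z) ↔ ((p ^ j : ℕ) : ℤ) ∣ MvPolynomial.eval n Q := by
    intro n
    rw [hQf, show ((p ^ j : ℕ) : ℤ) ∣ R * f n ↔ ((p ^ j : ℕ) : ℤ) ∣ f n from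
      ⟨fun h => hcop.dvd_of_dvd_mul_left h, fun h => h.mul_left R⟩, hf n]
    constructor
    · rintro ⟨z, hz⟩
      rw [div_eq_iff hq] at hz
      exact ⟨z, by rw [mul_comm]; exact_mod_cast hz⟩
    · rintro ⟨z, hz⟩
      refine ⟨z, ?_⟩
      rw [hz, Int.cast_mul, Int.cast_natCast, mul_div_cancel_left₀ _ hq]
  refine ⟨Q, hQ, fun n => ⟨fun h z hz => ?_, fun h m => ?_⟩⟩
  · have h1 : ∀ i, ∃ m : ℤ, z i = n i + p * m := fun i => by
      have h2 : ((z i - n i : ℤ) : ZMod p) = 0 := by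
        rw [Int.cast_sub, hz i, sub_self]
      obtain ⟨m, hm⟩ := (ZMod.intCast_zmod_eq_zero_iff_dvd _ _).1 h2
      exact ⟨m, by linear_combination hm⟩
    choose m hm using h1
    have h3 := (key _).1 (h m)
    rwa [show z = n + (p : ℤ) • m from funext fun i => by simp [hm i]]
  · exact (key _).2 (h _ fun i => by simp)

lemma tauMap_injective [NeZero p] : Function.Injective (tauMap : (ι → ZMod p) → ι → ℤ) := by
  intro x y h
  funext i
  exact ZMod.val_injective p (Int.ofNat_injective (congrFun h i))

lemma tauMap_cast [NeZero p] (x : ι → ZMod p) : (fun i => ((tauMap x i : ℤ) : ZMod p)) = x := by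
  funext i
  simp [tauMap]

lemma reduceMod_tauMap_image [NeZero p] (Ω : Set (ι → ZMod p)) :
    reduceMod p (tauMap '' Ω) = tauMap '' Ω := by
  ext n
  constructor
  · rintro ⟨hn, m, x, hx, hxn⟩
    refine ⟨x, hx, funext fun i => ?_⟩
    have h1 : (x i) = (n i : ZMod p) := by
      have := congrArg (fun z : ℤ => (z : ZMod p)) (congrFun hxn i)
      simpa [tauMap] using this
    simp only [tauMap, h1, ZMod.val_intCast]
    exact Int.emod_eq_of_lt (hn i).1 (hn i).2
  · rintro ⟨x, hx, rfl⟩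
    refine ⟨fun i => ⟨Int.natCast_nonneg _, Int.ofNat_lt.2 (ZMod.val_lt (x i))⟩, 0, x, hx, by simp⟩

/-- The common source of the three kinds of irreducibility: integral polynomials modulo powers
of `p`. -/
def IsResidueIrreducible (δ : ℝ) (s : ℕ) (Ω : Set (ι → ZMod p)) : Prop :=
  ∀ (j : ℕ) (Q : MvPolynomial ι ℤ), Q.totalDegree ≤ s →
    (((residueZeros p (p ^ j) Q ∩ Ω).ncard : ℝ) ≤ δ * (Ω.ncard : ℝ)) ∨
      Ω ⊆ residueZeros p (p ^ j) Q

lemma IsResidueIrreducible.isDeltaIrreducible {δ : ℝ} {s : ℕ} {Ω : Set (ι → ZMod p)}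
    (h : IsResidueIrreducible δ s Ω) : IsDeltaIrreducible δ s Ω := by
  intro P hP
  obtain ⟨Q, hQ, hQx⟩ := IsPolyFun.exists_int_lift ⟨P, hP, fun x => rfl⟩
  have hset : residueZeros p (p ^ 1) Q = {n | MvPolynomial.eval n P = 0} := by
    ext n
    rw [pow_one]
    refine ⟨fun hn => ?_, fun hn z hz => ?_⟩
    · have h1 := hn (fun i => ((n i).cast : ℤ)) (fun i => by simp)
      rw [← ZMod.intCast_zmod_eq_zero_iff_dvd, hQx] at h1
      simpa using h1
    · rw [← ZMod.intCast_zmod_eq_zero_iff_dvd, hQx]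
      simp only [hz]
      exact hn
  rw [← hset]
  exact h 1 Q hQ

lemma IsResidueIrreducible.real_dichotomy [Fact p.Prime] [Fintype ι] {δ : ℝ} {s j : ℕ}
    {Ω : Set (ι → ZMod p)} (h : IsResidueIrreducible δ s Ω) (hs : s < p)
    (P : MvPolynomial ι ℝ) (hdeg : P.totalDegree ≤ s) (hP : TakesValuesIn (p ^ j) P) :
    (((intZeroSet p P ∩ reduceMod p (tauMap '' Ω)).ncard : ℝ) ≤
      δ * ((reduceMod p (tauMap '' Ω)).ncard : ℝ)) ∨
      reduceMod p (tauMap '' Ω) ⊆ intZeroSet p P := by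
  obtain ⟨Q, hQ, hQn⟩ := exists_intZeroSet_eq hs P hdeg hP
  have hmem : ∀ x : ι → ZMod p, tauMap x ∈ intZeroSet p P ↔ x ∈ residueZeros p (p ^ j) Q :=
    fun x => by rw [hQn, tauMap_cast]
  rw [reduceMod_tauMap_image]
  have hset : intZeroSet p P ∩ tauMap '' Ω = tauMap '' (residueZeros p (p ^ j) Q ∩ Ω) := by
    ext n
    constructor
    · rintro ⟨hn, x, hx, rfl⟩
      exact ⟨x, ⟨(hmem x).1 hn, hx⟩, rfl⟩
    · rintro ⟨x, ⟨hn, hx⟩, rfl⟩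
      exact ⟨(hmem x).2 hn, x, hx, rfl⟩
  rw [hset, Set.ncard_image_of_injective _ tauMap_injective,
    Set.ncard_image_of_injective _ tauMap_injective]
  refine (h j Q hQ).imp_right fun hΩ => ?_
  rintro _ ⟨x, hx, rfl⟩
  exact (hmem x).2 (hΩ hx)

end Reduction

/-! ### The bilinear form of `M` and quadratic functions -/

section Bilinear

variable {p d k : ℕ}

/-- The symmetric bilinear form `(x A) · y` on `𝔽_p^d`. -/
def FpQuadForm.bil (M : FpQuadForm p d) (x y : Fin d → ZMod p) : ZMod p := (x ᵥ* M.A) ⬝ᵥ y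

variable (M : FpQuadForm p d) (x y z : Fin d → ZMod p)

lemma FpQuadForm.bil_add_left : M.bil (x + y) z = M.bil x z + M.bil y z := by
  simp [FpQuadForm.bil, Matrix.add_vecMul]

lemma FpQuadForm.bil_add_right : M.bil x (y + z) = M.bil x y + M.bil x z := by
  simp [FpQuadForm.bil]

lemma FpQuadForm.bil_smul_left (c : ZMod p) : M.bil (c • x) y = c * M.bil x y := by
  simp [FpQuadForm.bil, Matrix.smul_vecMul]

lemma FpQuadForm.bil_smul_right (c : ZMod p) : M.bil x (c • y) = c * M.bil x y := by
  simp [FpQuadForm.bil]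

lemma FpQuadForm.bil_comm : M.bil x y = M.bil y x := by
  rw [FpQuadForm.bil, FpQuadForm.bil, ← Matrix.dotProduct_mulVec, dotProduct_comm,
    ← Matrix.vecMul_transpose, M.isSymm.eq]

@[simp] lemma FpQuadForm.bil_zero_left : M.bil 0 y = 0 := by simp [FpQuadForm.bil]

@[simp] lemma FpQuadForm.bil_zero_right : M.bil x 0 = 0 := by simp [FpQuadForm.bil]

lemma FpQuadForm.bil_sum_left {α : Type*} (s : Finset α) (f : α → Fin d → ZMod p) :
    M.bil (∑ a ∈ s, f a) y = ∑ a ∈ s, M.bil (f a) y := by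
  classical
  induction s using Finset.induction_on with
  | empty => simp
  | insert a s ha ih => simp [Finset.sum_insert ha, FpQuadForm.bil_add_left, ih]

lemma FpQuadForm.bil_sum_right {α : Type*} (s : Finset α) (f : α → Fin d → ZMod p) :
    M.bil x (∑ a ∈ s, f a) = ∑ a ∈ s, M.bil x (f a) := by
  classical
  induction s using Finset.induction_on with
  | empty => simp
  | insert a s ha ih => simp [Finset.sum_insert ha, FpQuadForm.bil_add_right, ih]

/-- By non-degeneracy, every linear functional is `M.bil · y` for some `y`. -/
lemma FpQuadForm.Nondegenerate.exists_bil_eq [Fact p.Prime] {M : FpQuadForm p d}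
    (hM : M.Nondegenerate) (w : Fin d → ZMod p) : ∃ y, ∀ x, M.bil x y = x ⬝ᵥ w := by
  refine ⟨M.A⁻¹ *ᵥ w, fun x => ?_⟩
  rw [FpQuadForm.bil, Matrix.dotProduct_mulVec, Matrix.vecMul_vecMul,
    Matrix.mul_nonsing_inv _ (isUnit_iff_ne_zero.2 hM), Matrix.vecMul_one]

lemma FpQuadForm.Nondegenerate.exists_bil_ne_zero [Fact p.Prime] {M : FpQuadForm p d}
    (hM : M.Nondegenerate) {x : Fin d → ZMod p} (hx : x ≠ 0) : ∃ y, M.bil x y ≠ 0 := by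
  obtain ⟨l, hl⟩ := Function.ne_iff.1 hx
  obtain ⟨y, hy⟩ := hM.exists_bil_eq (Pi.single l 1)
  exact ⟨y, by simpa [hy] using hl⟩

lemma FpPoint.block_add (m n : FpPoint p d k) (i : Fin k) :
    FpPoint.block (m + n) i = FpPoint.block m i + FpPoint.block n i := rfl

/-- The point whose only non-zero block is `x`, in position `i`. -/
def FpPoint.single (i : Fin k) (x : Fin d → ZMod p) : FpPoint p d k :=
  fun q => if q.1 = i then x q.2 else 0

lemma FpPoint.block_single (i j : Fin k) :
    FpPoint.block (FpPoint.single i x) j = if j = i then x else 0 := by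
  funext l
  by_cases h : j = i <;> simp [FpPoint.block, FpPoint.single, h]

/-- The derivative of the quadratic part of `F` at `h`, as a vector, in the direction of the
`i`-th block. -/
def quadGradient (F : MCoeff p d k) (i : Fin k) (h : FpPoint p d k) : Fin d → ZMod p :=
  ∑ q : {q : Fin k × Fin k // q.1 ≤ q.2}, F.1.1 q •
    ((if q.1.2 = i then FpPoint.block h q.1.1 else 0) +
      if q.1.1 = i then FpPoint.block h q.1.2 else 0)

lemma quadGradient_add (F : MCoeff p d k) (i : Fin k) (h h' : FpPoint p d k) :
    quadGradient F i (h + h') = quadGradient F i h + quadGradient F i h' := by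
  simp only [quadGradient, ← Finset.sum_add_distrib, ← smul_add]
  refine Finset.sum_congr rfl fun q _ => ?_
  split_ifs <;> simp only [FpPoint.block_add, add_zero, zero_add]
  abel_nf

lemma FpQuadForm.quadFun_eq (F : MCoeff p d k) (n : FpPoint p d k) :
    M.quadFun F n = (∑ q : {q : Fin k × Fin k // q.1 ≤ q.2},
      F.1.1 q * M.bil (FpPoint.block n q.1.1) (FpPoint.block n q.1.2)) +
      (∑ i : Fin k, F.1.2 i ⬝ᵥ FpPoint.block n i) + F.2 := rfl

lemma FpQuadForm.quadFun_second_difference (F : MCoeff p d k) (n h : FpPoint p d k) (i : Fin k)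
    (x : Fin d → ZMod p) :
    M.quadFun F (n + FpPoint.single i x + h) - M.quadFun F (n + FpPoint.single i x) =
      M.quadFun F (n + h) - M.quadFun F n + M.bil (quadGradient F i h) x := by
  have hgrad : M.bil (quadGradient F i h) x = ∑ q : {q : Fin k × Fin k // q.1 ≤ q.2},
      F.1.1 q * (M.bil (FpPoint.block (FpPoint.single i x) q.1.1) (FpPoint.block h q.1.2) +
        M.bil (FpPoint.block h q.1.1) (FpPoint.block (FpPoint.single i x) q.1.2)) := by
    rw [quadGradient, FpQuadForm.bil_sum_left]
    refine Finset.sum_congr rfl fun q _ => ?_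
    rw [FpQuadForm.bil_smul_left, FpQuadForm.bil_add_left, FpPoint.block_single,
      FpPoint.block_single]
    split_ifs <;> simp [M.bil_comm x, add_comm]
  simp only [FpQuadForm.quadFun_eq, hgrad, FpPoint.block_add, FpQuadForm.bil_add_left,
    FpQuadForm.bil_add_right, mul_add, dotProduct_add, Finset.sum_add_distrib]
  ring

end Bilinear

/-! ### Exponential sums and the number of zeros -/

section ExponentialSums

variable {p : ℕ} [Fact p.Prime]

lemma sum_stdAddChar_eq_zero {G : Type*} [AddCommGroup G] [Fintype G] {f : G → ZMod p} {e : G}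
    {c : ZMod p} (hc : c ≠ 0) (hf : ∀ n, f (n + e) = f n + c) :
    ∑ n, ZMod.stdAddChar (f n) = (0 : ℂ) := by
  have h1 : ∑ n, (ZMod.stdAddChar (f n) : ℂ) =
      (∑ n, ZMod.stdAddChar (f n)) * ZMod.stdAddChar c := by
    rw [Finset.sum_mul, ← Equiv.sum_comp (Equiv.addRight e)]
    exact Finset.sum_congr rfl fun n _ => by
      rw [Equiv.coe_addRight, hf, AddChar.map_add_eq_mul]
  have h2 : (ZMod.stdAddChar c : ℂ) ≠ 1 := fun h =>
    hc (ZMod.injective_stdAddChar (by simpa using h))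
  by_contra hne
  exact h2 (mul_left_cancel₀ hne (by rw [mul_one]; exact h1.symm))

/-- Weyl differencing: the square of an exponential sum is bounded by the number of shifts whose
difference function is not equidistributed. -/
lemma norm_sum_stdAddChar_sq_le {G : Type*} [AddCommGroup G] [Fintype G] (f : G → ZMod p)
    (B : Set G) (hB : ∀ h ∉ B, ∃ e c, c ≠ 0 ∧
      ∀ n, f (n + e + h) - f (n + e) = f (n + h) - f n + c) :
    ‖∑ n, (ZMod.stdAddChar (f n) : ℂ)‖ ^ 2 ≤ B.ncard * Fintype.card G := by
  classical
  have h1 : (∑ n, (ZMod.stdAddChar (f n) : ℂ)) * (starRingEnd ℂ) (∑ n, ZMod.stdAddChar (f n)) =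
      ∑ h, ∑ n, (ZMod.stdAddChar (f (n + h) - f n) : ℂ) := by
    rw [map_sum, Finset.mul_sum, Finset.sum_comm (γ := G)]
    refine Finset.sum_congr rfl fun n _ => ?_
    rw [Finset.sum_mul, ← Equiv.sum_comp (Equiv.addLeft n)]
    refine Finset.sum_congr rfl fun h _ => ?_
    rw [Equiv.coe_addLeft, sub_eq_add_neg, AddChar.map_add_eq_mul, AddChar.map_neg_eq_conj]
  have h2 : ∀ h, ‖∑ n, (ZMod.stdAddChar (f (n + h) - f n) : ℂ)‖ ≤
      if h ∈ B then (Fintype.card G : ℝ) else 0 := by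
    intro h
    split_ifs with hh
    · refine (norm_sum_le _ _).trans ?_
      simp
    · obtain ⟨e, c, hc, hf⟩ := hB h hh
      rw [sum_stdAddChar_eq_zero hc hf, norm_zero]
  calc ‖∑ n, (ZMod.stdAddChar (f n) : ℂ)‖ ^ 2
      = ‖(∑ n, (ZMod.stdAddChar (f n) : ℂ)) * (starRingEnd ℂ) (∑ n, ZMod.stdAddChar (f n))‖ := by
        rw [norm_mul, RCLike.norm_conj, sq]
    _ ≤ ∑ h, if h ∈ B then (Fintype.card G : ℝ) else 0 := by
        rw [h1]
        exact (norm_sum_le _ _).trans (Finset.sum_le_sum fun h _ => h2 h)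
    _ = B.ncard * Fintype.card G := by
        rw [← Finset.sum_filter, Finset.sum_const, nsmul_eq_mul, Set.ncard_eq_toFinset_card',
          Set.toFinset]
        congr 2
        refine congrArg _ ?_
        ext; simp

/-- Counting common zeros by exponential sums. -/
lemma abs_ncard_zeros_sub_le {G : Type*} [AddCommGroup G] [Fintype G] {r : ℕ}
    (f : Fin r → G → ZMod p) {E : ℝ} (hE0 : 0 ≤ E)
    (hE : ∀ ξ : Fin r → ZMod p, ξ ≠ 0 → ‖∑ n, (ZMod.stdAddChar (∑ i, ξ i * f i n) : ℂ)‖ ≤ E) :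
    |({n | ∀ i, f i n = 0}.ncard : ℝ) - Fintype.card G / (p : ℝ) ^ r| ≤ E := by
  classical
  have hp : (0 : ℝ) < p := by exact_mod_cast (Fact.out : p.Prime).pos
  have hpr : (0 : ℝ) < (p : ℝ) ^ r := pow_pos hp r
  have hdetect : ∀ n, ∑ ξ : Fin r → ZMod p, (ZMod.stdAddChar (∑ i, ξ i * f i n) : ℂ) =
      if ∀ i, f i n = 0 then (p : ℂ) ^ r else 0 := by
    intro n
    split_ifs with h
    · simp [h, ZMod.card]
    · push Not at h
      obtain ⟨i, hi⟩ := h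
      refine sum_stdAddChar_eq_zero (e := Pi.single i 1) hi fun ξ => ?_
      simp [add_mul, Finset.sum_add_distrib, Pi.single_apply]
  have hcount : (({n | ∀ i, f i n = 0}.ncard : ℂ)) * (p : ℂ) ^ r - Fintype.card G =
      ∑ ξ ∈ Finset.univ.erase (0 : Fin r → ZMod p),
        ∑ n, (ZMod.stdAddChar (∑ i, ξ i * f i n) : ℂ) := by
    have h1 : ∑ ξ : Fin r → ZMod p, ∑ n, (ZMod.stdAddChar (∑ i, ξ i * f i n) : ℂ) =
        ({n | ∀ i, f i n = 0}.ncard : ℂ) * (p : ℂ) ^ r := by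
      rw [Finset.sum_comm, Finset.sum_congr rfl fun n _ => hdetect n, ← Finset.sum_filter,
        Finset.sum_const, nsmul_eq_mul, Set.ncard_eq_toFinset_card', Set.toFinset_ofPred]
    rw [← h1, ← Finset.add_sum_erase _ _ (Finset.mem_univ (0 : Fin r → ZMod p))]
    simp
  have hnorm : |({n | ∀ i, f i n = 0}.ncard : ℝ) * (p : ℝ) ^ r - Fintype.card G| ≤
      ((p : ℝ) ^ r - 1) * E := by
    have h1 := congrArg norm hcount
    have h2 : (({n | ∀ i, f i n = 0}.ncard : ℂ)) * (p : ℂ) ^ r - Fintype.card G =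
        ((({n | ∀ i, f i n = 0}.ncard : ℝ) * (p : ℝ) ^ r - Fintype.card G : ℝ) : ℂ) := by
      push_cast; rfl
    rw [h2, Complex.norm_real, Real.norm_eq_abs] at h1
    rw [h1]
    refine (norm_sum_le _ _).trans ?_
    refine (Finset.sum_le_sum fun ξ hξ => hE ξ (Finset.ne_of_mem_erase hξ)).trans ?_
    rw [Finset.sum_const, nsmul_eq_mul, Finset.card_erase_of_mem (Finset.mem_univ _),
      Finset.card_univ, Fintype.card_fun, ZMod.card, Fintype.card_fin,
      Nat.cast_sub (Nat.one_le_pow _ _ (Fact.out : p.Prime).pos)]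
    simp
  calc |({n | ∀ i, f i n = 0}.ncard : ℝ) - Fintype.card G / (p : ℝ) ^ r|
      = |({n | ∀ i, f i n = 0}.ncard : ℝ) * (p : ℝ) ^ r - Fintype.card G| / (p : ℝ) ^ r := by
        rw [← abs_of_pos hpr, ← abs_div, abs_of_pos hpr, sub_div, mul_div_cancel_right₀ _ hpr.ne']
    _ ≤ E := by
        rw [div_le_iff₀ hpr]
        nlinarith

/-- A fibre count: a linear map with a section onto `𝔽_p^d` has a kernel of index `p ^ d`. -/
lemma ncard_zeros_mul_le_of_section {G : Type*} [AddCommGroup G] [Fintype G] {d : ℕ}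
    (w : G → Fin d → ZMod p) (hw : ∀ g g', w (g + g') = w g + w g')
    (t : (Fin d → ZMod p) → G) (ht : ∀ u, w (t u) = u) :
    {g | w g = 0}.ncard * p ^ d ≤ Fintype.card G := by
  have h1 : ({g | w g = 0} ×ˢ (Set.univ : Set (Fin d → ZMod p))).ncard =
      {g | w g = 0}.ncard * p ^ d := by
    rw [Set.ncard_prod, Set.ncard_univ, Nat.card_eq_fintype_card, Fintype.card_fun, ZMod.card,
      Fintype.card_fin]
  rw [← h1, ← Nat.card_eq_fintype_card, ← Set.ncard_univ]
  refine Set.ncard_le_ncard_of_injOn (fun g => g.1 + t g.2) (fun _ _ => Set.mem_univ _) ?_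
    (Set.toFinite _)
  rintro ⟨g, u⟩ ⟨hg, -⟩ ⟨g', u'⟩ ⟨hg', -⟩ h
  have hu : u = u' := by
    have := congrArg w h
    simp only [hw, ht] at this
    rwa [show w g = 0 from hg, show w g' = 0 from hg', zero_add, zero_add] at this
  subst hu
  simpa using h

variable {d k : ℕ}

lemma card_fpPoint : Fintype.card (FpPoint p d k) = p ^ (k * d) := by
  rw [Fintype.card_fun, ZMod.card, Fintype.card_prod, Fintype.card_fin, Fintype.card_fin]

/-- The exponential sum bound for a quadratic function with a non-constant term. If some `b_{i,j}`
is non-zero, then the `i`-th gradient vanishes on a subspace of codimension `d`. -/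
lemma FpQuadForm.Nondegenerate.norm_sum_quadFun_le (hp2 : p ≠ 2) {M : FpQuadForm p d}
    (hM : M.Nondegenerate) {F : MCoeff p d k} (hF : F.1 ≠ 0) :
    ‖∑ n : FpPoint p d k, (ZMod.stdAddChar (M.quadFun F n) : ℂ)‖ ≤
      (p : ℝ) ^ (k * d) / √p ^ d := by
  have hp : (0 : ℝ) < p := by exact_mod_cast (Fact.out : p.Prime).pos
  have hsq : (0 : ℝ) < √p := Real.sqrt_pos.2 hp
  by_cases hb : F.1.1 = 0
  · have hv : F.1.2 ≠ 0 := fun hv => hF (Prod.ext hb hv)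
    obtain ⟨i, hi⟩ := Function.ne_iff.1 hv
    obtain ⟨l, hl⟩ := Function.ne_iff.1 hi
    rw [sum_stdAddChar_eq_zero (e := FpPoint.single i (Pi.single l 1)) (c := F.1.2 i l) hl,
      norm_zero]
    · positivity
    · intro n
      simp only [FpQuadForm.quadFun_eq, hb, FpPoint.block_add, dotProduct_add,
        Finset.sum_add_distrib, FpPoint.block_single, Pi.zero_apply, zero_mul]
      have : ∑ j, F.1.2 j ⬝ᵥ (if j = i then Pi.single l 1 else 0) = F.1.2 i l := by
        rw [Finset.sum_eq_single_of_mem i (Finset.mem_univ i)]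
        · simp
        · intro j _ hj
          simp [hj]
      rw [this]
      ring
  obtain ⟨q, hq⟩ := Function.ne_iff.1 hb
  have h2 : (2 : ZMod p) ≠ 0 :=
    Ring.two_ne_zero (by rwa [ZMod.ringChar_zmod_n])
  replace hq : F.1.1 q ≠ 0 := hq
  set κ : ZMod p := if q.1.1 = q.1.2 then 2 * F.1.1 q else F.1.1 q
  have hκ : κ ≠ 0 := by
    simp only [κ]
    split_ifs
    · exact mul_ne_zero h2 hq
    · exact hq
  have hsec : ∀ u, quadGradient F q.1.1 (FpPoint.single q.1.2 (κ⁻¹ • u)) = u := by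
    intro u
    have hu : κ • κ⁻¹ • u = u := by rw [smul_smul, mul_inv_cancel₀ hκ, one_smul]
    rw [quadGradient, Finset.sum_eq_single_of_mem q (Finset.mem_univ q)]
    · rw [FpPoint.block_single, FpPoint.block_single, if_pos rfl, if_pos rfl]
      by_cases h : q.1.1 = q.1.2
      · rw [if_pos h.symm, if_pos h, ← two_smul (ZMod p), smul_smul, mul_comm]
        simpa only [κ, if_pos h] using hu
      · rw [if_neg (Ne.symm h), zero_add]
        simpa only [κ, if_neg h] using hu
    · intro q' _ hq'
      rw [FpPoint.block_single, FpPoint.block_single]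
      have hne : ¬ (q'.1.1 = q.1.1 ∧ q'.1.2 = q.1.2) := fun h =>
        hq' (Subtype.ext (Prod.ext h.1 h.2))
      have h1 := q.2
      have h2 := q'.2
      have h3 : ¬ (q'.1.2 = q.1.1 ∧ q'.1.1 = q.1.2) := by
        rintro ⟨h3, h4⟩
        refine hne ⟨?_, ?_⟩ <;> omega
      have h4 : (if q'.1.2 = q.1.1 then if q'.1.1 = q.1.2 then κ⁻¹ • u else 0 else 0) = 0 := by
        split_ifs <;> tauto
      have h5 : (if q'.1.1 = q.1.1 then if q'.1.2 = q.1.2 then κ⁻¹ • u else 0 else 0) = 0 := by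
        split_ifs <;> tauto
      rw [h4, h5, add_zero, smul_zero]
  set B : Set (FpPoint p d k) := {h | quadGradient F q.1.1 h = 0}
  have h3 := norm_sum_stdAddChar_sq_le (fun n => M.quadFun F n) B (fun h hh => by
    obtain ⟨x, hx⟩ := hM.exists_bil_ne_zero hh
    exact ⟨FpPoint.single q.1.1 x, _, hx, fun n => M.quadFun_second_difference F n h q.1.1 x⟩)
  have h4 := ncard_zeros_mul_le_of_section (quadGradient F q.1.1) (quadGradient_add F q.1.1) _ hsec
  rw [card_fpPoint] at h3 h4
  have h4' : (B.ncard : ℝ) * (p : ℝ) ^ d ≤ (p : ℝ) ^ (k * d) := by exact_mod_cast h4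
  rw [Nat.cast_pow] at h3
  refine le_of_sq_le_sq ?_ (by positivity)
  rw [div_pow, pow_right_comm √p, Real.sq_sqrt hp.le, le_div_iff₀ (pow_pos hp d)]
  calc _ ≤ (B.ncard : ℝ) * (p : ℝ) ^ (k * d) * (p : ℝ) ^ d := by gcongr
    _ = (B.ncard : ℝ) * (p : ℝ) ^ d * (p : ℝ) ^ (k * d) := by ring
    _ ≤ _ := by rw [sq]; gcongr

/-- The common zeros of an independent family are equidistributed. -/
lemma FpQuadForm.Nondegenerate.abs_ncard_zeroSet_sub_le (hp2 : p ≠ 2) {M : FpQuadForm p d}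
    (hM : M.Nondegenerate) {r : ℕ} {F : Fin r → MCoeff p d k} (hF : IsIndependentFamily F) :
    |((M.zeroSet F).ncard : ℝ) - (p : ℝ) ^ (k * d) / (p : ℝ) ^ r| ≤
      (p : ℝ) ^ (k * d) / √p ^ d := by
  have hsum : ∀ (ξ : Fin r → ZMod p) (n : FpPoint p d k),
      ∑ i, ξ i * M.quadFun (F i) n = M.quadFun (∑ i, ξ i • F i) n := by
    intro ξ n
    let φ : MCoeff p d k →ₗ[ZMod p] ZMod p :=
      { toFun := fun G => M.quadFun G n
        map_add' := fun G G' => M.quadFun_add G G' n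
        map_smul' := fun c G => M.quadFun_smul c G n }
    change _ = φ _
    rw [map_sum]
    exact Finset.sum_congr rfl fun i _ => (M.quadFun_smul (ξ i) (F i) n).symm
  have h := abs_ncard_zeros_sub_le (fun i n => M.quadFun (F i) n)
    (E := (p : ℝ) ^ (k * d) / √p ^ d) (by positivity) (fun ξ hξ => by
      simp only [hsum]
      refine hM.norm_sum_quadFun_le hp2 fun h0 => hξ ?_
      rw [Prod.fst_sum] at h0
      exact funext (Fintype.linearIndependent_iff.1 hF ξ h0))
  rw [card_fpPoint] at h
  exact_mod_cast h

end ExponentialSums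

/-! ### Totally isotropic families -/

section Isotropic

variable {p d k : ℕ} [Fact p.Prime]

lemma finrank_le_finrank_inf_ker_add_one {F V : Type*} [Field F] [AddCommGroup V] [Module F V]
    [FiniteDimensional F V] (W : Submodule F V) (φ : V →ₗ[F] F) :
    Module.finrank F W ≤ Module.finrank F ↥(W ⊓ LinearMap.ker φ) + 1 := by
  have h1 := Submodule.finrank_sup_add_finrank_inf_eq W (LinearMap.ker φ)
  have h2 := LinearMap.finrank_range_add_finrank_ker φ
  have h3 := Submodule.finrank_le (W ⊔ LinearMap.ker φ)
  have h4 := Submodule.finrank_le (LinearMap.range φ)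
  rw [Module.finrank_self] at h4
  omega

lemma finrank_le_finrank_inf_iInf_ker_add {F V : Type*} [Field F] [AddCommGroup V] [Module F V]
    [FiniteDimensional F V] {m : ℕ} (φ : Fin m → V →ₗ[F] F) :
    Module.finrank F V ≤ Module.finrank F ↥(⨅ i, LinearMap.ker (φ i)) + m := by
  induction m with
  | zero =>
    rw [iInf_of_empty, finrank_top, add_zero]
  | succ m ih =>
    have h1 := ih (fun i => φ i.succ)
    have h2 := finrank_le_finrank_inf_ker_add_one (⨅ i : Fin m, LinearMap.ker (φ i.succ)) (φ 0)
    have h3 : (⨅ i, LinearMap.ker (φ i)) =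
        (⨅ i : Fin m, LinearMap.ker (φ i.succ)) ⊓ LinearMap.ker (φ 0) := by
      ext v
      simp [Fin.forall_fin_succ, and_comm]
    rw [h3]
    omega

/-- Linearly independent vectors have a dual family for the dot product. -/
lemma LinearIndependent.exists_dotProduct_eq {F ι : Type*} [Field F] [Fintype ι] {m : ℕ}
    {y : Fin m → ι → F} (hy : LinearIndependent F y) :
    ∃ v : Fin m → ι → F, ∀ i j, y i ⬝ᵥ v j = if i = j then 1 else 0 := by
  classical
  obtain ⟨g, hg⟩ := LinearMap.exists_leftInverse_of_injective (Fintype.linearCombination F y)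
    (LinearMap.ker_eq_bot.2 hy.fintypeLinearCombination_injective)
  refine ⟨fun j l => g (Pi.single l 1) j, fun i j => ?_⟩
  have h1 : g (y i) = Pi.single i 1 := by
    have := LinearMap.congr_fun hg (Pi.single i 1)
    simpa [Fintype.linearCombination_apply_single] using this
  have h2 : g (y i) = ∑ l, y i l • g (Pi.single l 1) := by
    conv_lhs => rw [pi_eq_sum_univ' (y i)]
    rw [map_sum]
    refine Finset.sum_congr rfl fun l _ => ?_
    rw [map_smul]
  have h3 := congrFun (h2.symm.trans h1) j
  rw [Finset.sum_apply] at h3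
  simpa [dotProduct, Pi.single_apply, eq_comm] using h3

variable (M : FpQuadForm p d)

/-- The linear functional `M.bil · y`. -/
def FpQuadForm.bilRight (y : Fin d → ZMod p) : (Fin d → ZMod p) →ₗ[ZMod p] ZMod p where
  toFun x := M.bil x y
  map_add' x x' := M.bil_add_left x x' y
  map_smul' c x := M.bil_smul_left x y c

@[simp] lemma FpQuadForm.bilRight_apply (x y : Fin d → ZMod p) : M.bilRight y x = M.bil x y := rfl

/-- By Chevalley–Warning, three dimensions contain an isotropic vector. -/
lemma FpQuadForm.exists_isotropic {W : Submodule (ZMod p) (Fin d → ZMod p)}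
    (hW : 3 ≤ Module.finrank (ZMod p) W) : ∃ w ∈ W, w ≠ 0 ∧ M.bil w w = 0 := by
  obtain ⟨b, hb⟩ := exists_linearIndependent_of_le_finrank hW
  have hb' : LinearIndependent (ZMod p) (fun i => (b i : Fin d → ZMod p)) :=
    hb.map' W.subtype (Submodule.ker_subtype W)
  obtain ⟨P, hP, hPx⟩ : IsPolyFun 2 (fun x : Fin 3 → ZMod p =>
      M.bil (∑ i, x i • (b i : Fin d → ZMod p)) (∑ j, x j • (b j : Fin d → ZMod p))) := by
    simp only [FpQuadForm.bil_sum_left, FpQuadForm.bil_sum_right, FpQuadForm.bil_smul_left,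
      FpQuadForm.bil_smul_right, Finset.mul_sum, ← mul_assoc]
    refine IsPolyFun.sum _ fun i _ => IsPolyFun.sum _ fun j _ => ?_
    exact ((IsPolyFun.coord i).mul (IsPolyFun.coord j)).mul_const _
  have hdvd := char_dvd_card_solutions p (f := P) (by simpa using Nat.lt_succ_of_le hP)
  have hpos : 0 < Fintype.card {x // MvPolynomial.eval x P = 0} :=
    Fintype.card_pos_iff.2 ⟨0, by rw [hPx]; simp⟩
  have hone := (Fact.out : p.Prime).one_lt.trans_le (Nat.le_of_dvd hpos hdvd)
  obtain ⟨⟨x, hx⟩, hx0⟩ := Fintype.exists_ne_of_one_lt_card hone ⟨0, by rw [hPx]; simp⟩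
  refine ⟨∑ i, x i • (b i : Fin d → ZMod p), W.sum_mem fun i _ => W.smul_mem _ (b i).2, ?_, ?_⟩
  · intro h
    exact hx0 (Subtype.ext (funext (Fintype.linearIndependent_iff.1 hb' x h)))
  · exact (hPx x).symm.trans hx

/-- Isotropic vectors are split off one at a time. -/
lemma FpQuadForm.exists_isotropic_family (m : ℕ) {W : Submodule (ZMod p) (Fin d → ZMod p)}
    (hW : 2 * m + 1 ≤ Module.finrank (ZMod p) W) :
    ∃ y : Fin m → Fin d → ZMod p, LinearIndependent (ZMod p) y ∧ (∀ i, y i ∈ W) ∧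
      ∀ i j, M.bil (y i) (y j) = 0 := by
  induction m generalizing W with
  | zero => exact ⟨Fin.elim0, linearIndependent_empty_type, fun i => i.elim0, fun i => i.elim0⟩
  | succ m ih =>
    obtain ⟨w, hwW, hw0, hww⟩ := M.exists_isotropic (W := W) (by omega)
    obtain ⟨φ, hφ, -⟩ := Submodule.exists_le_ker_of_notMem (p := (⊥ : Submodule (ZMod p) _))
      (v := w) (by simpa using hw0)
    have h1 := finrank_le_finrank_inf_ker_add_one W (M.bilRight w)
    have h2 := finrank_le_finrank_inf_ker_add_one (W ⊓ LinearMap.ker (M.bilRight w)) φ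
    obtain ⟨y, hy, hyW, hyy⟩ := ih (W := W ⊓ LinearMap.ker (M.bilRight w) ⊓ LinearMap.ker φ)
      (by omega)
    have hyw : ∀ i, M.bil (y i) w = 0 := fun i => (hyW i).1.2
    refine ⟨Fin.cons w y, linearIndependent_finCons.2 ⟨hy, fun hmem => hφ ?_⟩, ?_, ?_⟩
    · have hle : Submodule.span (ZMod p) (Set.range y) ≤ LinearMap.ker φ :=
        Submodule.span_le.2 (by rintro _ ⟨i, rfl⟩; exact (hyW i).2)
      exact hle hmem
    · exact Fin.cases hwW fun i => (hyW i).1.1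
    · refine Fin.cases (Fin.cases hww fun j => ?_) fun i => Fin.cases (hyw i) fun j => hyy i j
      simpa [M.bil_comm w] using hyw j

variable {M}

/-- A totally isotropic family can be completed to hyperbolic pairs. -/
lemma FpQuadForm.Nondegenerate.exists_dual_isotropic_family (hM : M.Nondegenerate) (hp2 : p ≠ 2)
    {m : ℕ} {y : Fin m → Fin d → ZMod p} (hy : LinearIndependent (ZMod p) y)
    (hyy : ∀ i j, M.bil (y i) (y j) = 0) :
    ∃ f : Fin m → Fin d → ZMod p, (∀ i j, M.bil (f i) (f j) = 0) ∧
      ∀ i j, M.bil (y i) (f j) = if i = j then 1 else 0 := by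
  have h2 : (2 : ZMod p) ≠ 0 := Ring.two_ne_zero (by rwa [ZMod.ringChar_zmod_n])
  obtain ⟨v, hv⟩ := hy.exists_dotProduct_eq
  choose g hg using fun j => hM.exists_bil_eq (v j)
  have hyg : ∀ i j, M.bil (y i) (g j) = if i = j then 1 else 0 := fun i j => by rw [hg, hv]
  have hgy : ∀ i j, M.bil (g i) (y j) = if i = j then 1 else 0 := fun i j => by
    rw [M.bil_comm, hyg]; simp [eq_comm]
  refine ⟨fun j => g j - ∑ l, (2⁻¹ * M.bil (g j) (g l)) • y l, fun i j => ?_, fun i j => ?_⟩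
  · simp only [sub_eq_add_neg, ← neg_one_smul (ZMod p) (∑ _, _), M.bil_add_left, M.bil_add_right,
      M.bil_smul_left, M.bil_smul_right, M.bil_sum_left, M.bil_sum_right, hyy, hyg, hgy]
    simp [M.bil_comm (g j) (g i)]
    field_simp
    ring
  · simp only [sub_eq_add_neg, ← neg_one_smul (ZMod p) (∑ _, _), M.bil_add_right,
      M.bil_smul_right, M.bil_sum_right, hyy, hyg]
    simp

/-- The matrix of the pairings of the blocks of `x` with the vectors `f j`. -/
def FpQuadForm.pairing (M : FpQuadForm p d) (f : Fin k → Fin d → ZMod p) (x : FpPoint p d k) :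
    Matrix (Fin k) (Fin k) (ZMod p) :=
  Matrix.of fun i j => M.bil (FpPoint.block x i) (f j)

lemma ncard_det_add_smul_one_le (a : Matrix (Fin k) (Fin k) (ZMod p)) :
    {t : ZMod p | (a + t • (1 : Matrix (Fin k) (Fin k) (ZMod p))).det = 0}.ncard ≤ k := by
  classical
  have hne : (-a).charpoly ≠ 0 := (Matrix.charpoly_monic _).ne_zero
  have hsub : {t : ZMod p | (a + t • (1 : Matrix (Fin k) (Fin k) (ZMod p))).det = 0} ⊆
      ((-a).charpoly.roots.toFinset : Set (ZMod p)) := by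
    intro t ht
    rw [Finset.mem_coe, Multiset.mem_toFinset, Polynomial.mem_roots hne, Polynomial.IsRoot,
      Matrix.eval_charpoly, sub_neg_eq_add, add_comm, Matrix.scalar_apply,
      ← Matrix.smul_one_eq_diagonal]
    exact ht
  refine (Set.ncard_le_ncard hsub (Finset.finite_toSet _)).trans ?_
  rw [Set.ncard_coe_finset]
  refine (Multiset.toFinset_card_le _).trans ((Polynomial.card_roots' _).trans ?_)
  rw [Matrix.charpoly_natDegree_eq_dim, Fintype.card_fin]

/-- A vector with `x · x ≠ 0` pairs non-trivially with some isotropic vector. -/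
lemma FpQuadForm.Nondegenerate.exists_isotropic_pairing_ne_zero (hM : M.Nondegenerate)
    (hp2 : p ≠ 2) (hd : 3 ≤ d) {x : Fin d → ZMod p} (hx : M.bil x x ≠ 0) :
    ∃ f, M.bil f f = 0 ∧ M.bil x f ≠ 0 := by
  have h2 : (2 : ZMod p) ≠ 0 := Ring.two_ne_zero (by rwa [ZMod.ringChar_zmod_n])
  obtain ⟨y, hy, -, hyy⟩ := M.exists_isotropic_family 1 (W := ⊤) (by simpa using hd)
  obtain ⟨f, hff, hyf⟩ := hM.exists_dual_isotropic_family hp2 hy hyy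
  by_cases h1 : M.bil x (y 0) = 0
  · by_cases h3 : M.bil x (f 0) = 0
    · have h4 : M.bil (y 0) (f 0) = 1 := by simp [hyf]
      refine ⟨y 0 + x + (-(2⁻¹ * M.bil x x)) • f 0, ?_, ?_⟩
      · simp only [M.bil_add_left, M.bil_add_right, M.bil_smul_left, M.bil_smul_right, hyy, hff, h1,
          h3, h4, M.bil_comm (y 0) x, M.bil_comm (f 0)]
        field_simp
        ring
      · rwa [M.bil_add_right, M.bil_add_right, M.bil_smul_right, h1, h3, zero_add, mul_zero,
          add_zero]
    · exact ⟨f 0, hff 0 0, h3⟩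
  · exact ⟨y 0, hyy 0 0, h1⟩

/-- Through every point `x` there is a line on which the Gram matrix is constant, and which is
almost entirely contained in the chart of some totally isotropic family `f`. The line degenerates
to `x` itself when the orthogonal complement of the blocks of `x` is too small, which happens only
for a single non-isotropic block. -/
lemma FpQuadForm.Nondegenerate.exists_line (hM : M.Nondegenerate) (hp2 : p ≠ 2) (hk : 0 < k)
    (hkd : 4 * k - 1 ≤ d) (x : FpPoint p d k) :
    ∃ (f : Fin k → Fin d → ZMod p) (y : FpPoint p d k), (∀ i j, M.bil (f i) (f j) = 0) ∧
      (∀ i j, M.bil (FpPoint.block y i) (FpPoint.block y j) = 0) ∧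
      (∀ i j, M.bil (FpPoint.block y i) (FpPoint.block x j) = 0) ∧
      {t : ZMod p | (M.pairing f (x + t • y)).det = 0}.ncard ≤ k := by
  have hline : ∀ y : Fin k → Fin d → ZMod p, LinearIndependent (ZMod p) y →
      (∀ i j, M.bil (y i) (y j) = 0) → (∀ i j, M.bil (y i) (FpPoint.block x j) = 0) →
      ∃ (f : Fin k → Fin d → ZMod p) (y : FpPoint p d k), (∀ i j, M.bil (f i) (f j) = 0) ∧
        (∀ i j, M.bil (FpPoint.block y i) (FpPoint.block y j) = 0) ∧
        (∀ i j, M.bil (FpPoint.block y i) (FpPoint.block x j) = 0) ∧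
        {t : ZMod p | (M.pairing f (x + t • y)).det = 0}.ncard ≤ k := by
    intro y hy hyy hyx
    obtain ⟨f, hff, hyf⟩ := hM.exists_dual_isotropic_family hp2 hy hyy
    refine ⟨f, fun q => y q.1 q.2, hff, hyy, hyx, ?_⟩
    have h1 : ∀ t : ZMod p, M.pairing f (x + t • fun q => y q.1 q.2) = M.pairing f x + t • 1 := by
      intro t
      ext i j
      have hb : FpPoint.block (x + t • fun q => y q.1 q.2 : FpPoint p d k) i =
        FpPoint.block x i + t • y i := rfl
      simp [FpQuadForm.pairing, hb, M.bil_add_left, M.bil_smul_left, hyf, Matrix.one_apply]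
    simp only [h1]
    exact ncard_det_add_smul_one_le _
  have hgen : ∀ W : Submodule (ZMod p) (Fin d → ZMod p), 2 * k + 1 ≤ Module.finrank (ZMod p) W →
      (∀ w ∈ W, ∀ j, M.bil w (FpPoint.block x j) = 0) → _ := fun W hW hWx =>
    let ⟨y, hy, hyW, hyy⟩ := M.exists_isotropic_family k hW
    hline y hy hyy fun i j => hWx (y i) (hyW i) j
  rcases Nat.lt_or_ge d (3 * k + 1) with hlt | hge
  · obtain rfl : k = 1 := by omega
    by_cases hxx : M.bil (FpPoint.block x 0) (FpPoint.block x 0) = 0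
    · by_cases hx0 : FpPoint.block x 0 = 0
      · refine hgen ⊤ (by simpa using hkd) fun w _ j => ?_
        rw [Subsingleton.elim j 0, hx0, M.bil_zero_right]
      · refine hline (FpPoint.block x) (LinearIndependent.of_subsingleton 0 hx0) (fun i j => ?_)
          fun i j => ?_
        all_goals rw [Subsingleton.elim i 0, Subsingleton.elim j 0, hxx]
    · obtain ⟨f, hff, hxf⟩ := hM.exists_isotropic_pairing_ne_zero hp2 (by omega) hxx
      refine ⟨fun _ => f, 0, fun _ _ => hff, fun _ _ => M.bil_zero_left _,
        fun _ _ => M.bil_zero_left _, ?_⟩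
      have : {t : ZMod p | (M.pairing (fun _ : Fin 1 => f)
          (x + t • (0 : FpPoint p d 1))).det = 0} = ∅ := by
        ext t
        simpa [FpQuadForm.pairing] using hxf
      rw [this, Set.ncard_empty]
      exact Nat.zero_le _
  · refine hgen (⨅ j, LinearMap.ker (M.bilRight (FpPoint.block x j))) ?_ fun w hw j => ?_
    · have := finrank_le_finrank_inf_iInf_ker_add (fun j => M.bilRight (FpPoint.block x j))
      rw [Module.finrank_fin_fun] at this
      omega
    · exact (Submodule.mem_iInf _).1 hw j

end Isotropic

/-! ### Rational charts of sets with prescribed Gram matrix -/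

section Chart

variable {p d k r : ℕ}

/-- The symmetric matrix with prescribed entries on and above the diagonal. -/
def symMat (w : {q : Fin k × Fin k // q.1 ≤ q.2} → ZMod p) : Matrix (Fin k) (Fin k) (ZMod p) :=
  Matrix.of fun i j => if h : i ≤ j then w ⟨(i, j), h⟩ else w ⟨(j, i), (not_le.1 h).le⟩

lemma symMat_apply (w : {q : Fin k × Fin k // q.1 ≤ q.2} → ZMod p)
    (q : {q : Fin k × Fin k // q.1 ≤ q.2}) : symMat w q.1.1 q.1.2 = w q := by
  simp [symMat, q.2]

lemma symMat_transpose (w : {q : Fin k × Fin k // q.1 ≤ q.2} → ZMod p) :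
    (symMat w)ᵀ = symMat w := by
  ext i j
  rcases lt_trichotomy i j with h | rfl | h
  · simp [symMat, h.le, h.not_ge]
  · simp [symMat]
  · simp [symMat, h.le, h.not_ge]

lemma symMat_add (w w' : {q : Fin k × Fin k // q.1 ≤ q.2} → ZMod p) :
    symMat (w + w') = symMat w + symMat w' := by
  ext i j
  by_cases h : i ≤ j <;> simp [symMat, h]

lemma symMat_zero : symMat (0 : {q : Fin k × Fin k // q.1 ≤ q.2} → ZMod p) = 0 := by
  ext i j
  simp [symMat]

variable (M : FpQuadForm p d) (f : Fin k → Fin d → ZMod p)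

/-- The displacement of the blocks of `x` by combinations of the isotropic vectors `f j` that
changes the Gram matrix of `x` by `symMat w`. It is meaningful where `M.pairing f x` is
invertible. -/
noncomputable def FpQuadForm.gramShift (x : FpPoint p d k)
    (w : {q : Fin k × Fin k // q.1 ≤ q.2} → ZMod p) :
    FpPoint p d k :=
  x + fun q => ∑ j, (2⁻¹ * (symMat w * ((M.pairing f x)⁻¹)ᵀ) q.1 j) * f j q.2

lemma FpQuadForm.block_gramShift (x : FpPoint p d k)
    (w : {q : Fin k × Fin k // q.1 ≤ q.2} → ZMod p) (i : Fin k) :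
    FpPoint.block (M.gramShift f x w) i = FpPoint.block x i +
      ∑ j, (2⁻¹ * (symMat w * ((M.pairing f x)⁻¹)ᵀ) i j) • f j := by
  funext l
  simp [FpPoint.block, FpQuadForm.gramShift, Finset.sum_apply]

lemma FpQuadForm.gramShift_zero (x : FpPoint p d k) : M.gramShift f x 0 = x := by
  funext q
  simp [FpQuadForm.gramShift, symMat_zero]

variable {f}

lemma FpQuadForm.pairing_gramShift (hf : ∀ i j, M.bil (f i) (f j) = 0) (x : FpPoint p d k)
    (w : {q : Fin k × Fin k // q.1 ≤ q.2} → ZMod p) :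
    M.pairing f (M.gramShift f x w) = M.pairing f x := by
  ext i j
  simp [FpQuadForm.pairing, M.block_gramShift, M.bil_add_left, M.bil_sum_left, M.bil_smul_left, hf]

lemma FpQuadForm.gramShift_gramShift (hf : ∀ i j, M.bil (f i) (f j) = 0) (x : FpPoint p d k)
    (w w' : {q : Fin k × Fin k // q.1 ≤ q.2} → ZMod p) :
    M.gramShift f (M.gramShift f x w) w' = M.gramShift f x (w + w') := by
  funext q
  have h := M.pairing_gramShift hf x w
  conv_lhs => rw [FpQuadForm.gramShift, h]
  simp only [FpQuadForm.gramShift, Pi.add_apply, symMat_add, Matrix.add_apply,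
    mul_add, add_mul, Finset.sum_add_distrib, add_assoc]

lemma FpQuadForm.bil_gramShift [Fact p.Prime] (hp2 : p ≠ 2)
    (hf : ∀ i j, M.bil (f i) (f j) = 0) {x : FpPoint p d k}
    (hx : (M.pairing f x).det ≠ 0) (w : {q : Fin k × Fin k // q.1 ≤ q.2} → ZMod p) (i j : Fin k) :
    M.bil (FpPoint.block (M.gramShift f x w) i) (FpPoint.block (M.gramShift f x w) j) =
      M.bil (FpPoint.block x i) (FpPoint.block x j) + symMat w i j := by
  have h2 : (2 : ZMod p) ≠ 0 := Ring.two_ne_zero (by rwa [ZMod.ringChar_zmod_n])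
  set a := M.pairing f x with ha
  set c := symMat w * (a⁻¹)ᵀ with hc
  have h1 : c * aᵀ = symMat w := by
    rw [hc, Matrix.mul_assoc, ← Matrix.transpose_mul,
      Matrix.mul_nonsing_inv _ (isUnit_iff_ne_zero.2 hx), Matrix.transpose_one, Matrix.mul_one]
  have h3 : a * cᵀ = symMat w := by
    rw [← Matrix.transpose_inj, Matrix.transpose_mul, Matrix.transpose_transpose, h1,
      symMat_transpose]
  have h4 : ∑ l, c i l * M.bil (f l) (FpPoint.block x j) = symMat w i j := by
    rw [← h1, Matrix.mul_apply]
    exact Finset.sum_congr rfl fun l _ => by rw [M.bil_comm]; rfl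
  have h5 : ∑ l, c j l * M.bil (FpPoint.block x i) (f l) = symMat w i j := by
    rw [← h3, Matrix.mul_apply]
    exact Finset.sum_congr rfl fun l _ => by rw [mul_comm]; rfl
  rw [M.block_gramShift, M.block_gramShift]
  simp only [M.bil_add_left, M.bil_add_right, M.bil_sum_left, M.bil_sum_right, M.bil_smul_left,
    M.bil_smul_right, hf, ← ha, ← hc, mul_assoc, ← Finset.mul_sum, h4, h5]
  simp
  field_simp
  ring

lemma FpQuadForm.quadFun_gramShift [Fact p.Prime] (hp2 : p ≠ 2)
    (hf : ∀ i j, M.bil (f i) (f j) = 0) {x : FpPoint p d k}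
    (hx : (M.pairing f x).det ≠ 0) (w : {q : Fin k × Fin k // q.1 ≤ q.2} → ZMod p)
    {F : MCoeff p d k} (hF : F.1.2 = 0) :
    M.quadFun F (M.gramShift f x w) = M.quadFun F x + F.1.1 ⬝ᵥ w := by
  simp only [M.quadFun_eq, hF, M.bil_gramShift hp2 hf hx, symMat_apply, mul_add,
    Finset.sum_add_distrib, dotProduct, Pi.zero_apply, zero_mul, Finset.sum_const_zero]
  ring

/-- The retraction of the open set `det (M.pairing f x) ≠ 0` onto its intersection with the zero set
of `F`: the displacement that cancels the values of `F`. Here `v` is dual to the coefficients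
of `F`. -/
noncomputable def FpQuadForm.retract (M : FpQuadForm p d) (f : Fin k → Fin d → ZMod p)
    (F : Fin r → MCoeff p d k) (v : Fin r → {q : Fin k × Fin k // q.1 ≤ q.2} → ZMod p)
    (x : FpPoint p d k) : FpPoint p d k :=
  M.gramShift f x (-∑ j, M.quadFun (F j) x • v j)

/-- Every fibre of the retraction has exactly `p ^ r` points. -/
lemma FpQuadForm.ncard_retract_preimage [Fact p.Prime] (hp2 : p ≠ 2)
    (hf : ∀ i j, M.bil (f i) (f j) = 0) {F : Fin r → MCoeff p d k} (hF : ∀ i, (F i).1.2 = 0)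
    {v : Fin r → {q : Fin k × Fin k // q.1 ≤ q.2} → ZMod p}
    (hv : ∀ i j, (F i).1.1 ⬝ᵥ v j = if i = j then 1 else 0) (S : Set (FpPoint p d k)) :
    {x | (M.pairing f x).det ≠ 0 ∧ M.retract f F v x ∈ S}.ncard =
      p ^ r * {z | z ∈ M.zeroSet F ∧ (M.pairing f z).det ≠ 0 ∧ z ∈ S}.ncard := by
  have hdot : ∀ (ξ : Fin r → ZMod p) i, (F i).1.1 ⬝ᵥ (∑ j, ξ j • v j) = ξ i := by
    intro ξ i
    simp [dotProduct_sum, hv]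
  have h1 : ((Set.univ : Set (Fin r → ZMod p)) ×ˢ
      {z | z ∈ M.zeroSet F ∧ (M.pairing f z).det ≠ 0 ∧ z ∈ S}).ncard =
      p ^ r * {z | z ∈ M.zeroSet F ∧ (M.pairing f z).det ≠ 0 ∧ z ∈ S}.ncard := by
    rw [Set.ncard_prod, Set.ncard_univ, Nat.card_eq_fintype_card, Fintype.card_fun, ZMod.card,
      Fintype.card_fin]
  have hval : ∀ z ∈ M.zeroSet F, (M.pairing f z).det ≠ 0 → ∀ (ξ : Fin r → ZMod p) i,
      M.quadFun (F i) (M.gramShift f z (∑ j, ξ j • v j)) = ξ i := by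
    intro z hz hdet ξ i
    rw [M.quadFun_gramShift hp2 hf hdet _ (hF i), hdot, hz i, zero_add]
  rw [← h1]
  symm
  refine Set.ncard_congr (fun g _ => M.gramShift f g.2 (∑ j, g.1 j • v j)) ?_ ?_ ?_
  · rintro ⟨ξ, z⟩ ⟨-, hz, hdet, hS⟩
    refine ⟨by rwa [M.pairing_gramShift hf], ?_⟩
    simp only [FpQuadForm.retract, hval z hz hdet ξ]
    rwa [M.gramShift_gramShift hf, add_neg_cancel, M.gramShift_zero]
  · rintro ⟨ξ, z⟩ ⟨ξ', z'⟩ ⟨-, hz, hdet, -⟩ ⟨-, hz', hdet', -⟩ h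
    have hξ : ξ = ξ' := funext fun i => by
      have := congrArg (M.quadFun (F i)) h
      simpa only [hval z hz hdet, hval z' hz' hdet'] using this
    subst hξ
    have h2 := congrArg (fun x => M.gramShift f x (-∑ j, ξ j • v j)) h
    simp only [M.gramShift_gramShift hf, add_neg_cancel, M.gramShift_zero] at h2
    rw [h2]
  · rintro x ⟨hdet, hS⟩
    refine ⟨(fun j => M.quadFun (F j) x, M.retract f F v x), ⟨Set.mem_univ _, fun i => ?_, ?_, hS⟩,
      ?_⟩
    · rw [FpQuadForm.retract, M.quadFun_gramShift hp2 hf hdet _ (hF i), dotProduct_neg, hdot,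
        add_neg_cancel]
    · rwa [FpQuadForm.retract, M.pairing_gramShift hf]
    · simp only [FpQuadForm.retract, M.gramShift_gramShift hf, neg_add_cancel, M.gramShift_zero]

lemma FpQuadForm.retract_eq_self {F : Fin r → MCoeff p d k}
    (v : Fin r → {q : Fin k × Fin k // q.1 ≤ q.2} → ZMod p) {z : FpPoint p d k}
    (hz : z ∈ M.zeroSet F) :
    M.retract f F v z = z := by
  have : ∀ j, M.quadFun (F j) z = 0 := hz
  simp [FpQuadForm.retract, this, M.gramShift_zero]

end Chart

section ChartPolynomials

variable {p d k r : ℕ} [Fact p.Prime] (M : FpQuadForm p d) (f : Fin k → Fin d → ZMod p)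

lemma FpQuadForm.isPolyFun_block (i : Fin k) (y : Fin d → ZMod p) :
    IsPolyFun 1 (fun x : FpPoint p d k => M.bil (FpPoint.block x i) y) := by
  have h : ∀ x : FpPoint p d k,
      M.bil (FpPoint.block x i) y = ∑ l, M.bil (Pi.single l 1) y * x (i, l) := by
    intro x
    conv_lhs => rw [pi_eq_sum_univ' (FpPoint.block x i)]
    rw [M.bil_sum_left]
    refine Finset.sum_congr rfl fun l _ => ?_
    rw [M.bil_smul_left, mul_comm]
    rfl
  simp only [h]
  exact IsPolyFun.sum _ fun l _ => IsPolyFun.const_mul _ (IsPolyFun.coord _)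

lemma FpQuadForm.isPolyFun_quadFun {F : MCoeff p d k} (hF : F.1.2 = 0) :
    IsPolyFun 2 (fun x : FpPoint p d k => M.quadFun F x) := by
  simp only [M.quadFun_eq, hF, Pi.zero_apply, zero_dotProduct, Finset.sum_const_zero, add_zero]
  refine (IsPolyFun.sum _ fun q _ => IsPolyFun.const_mul _ ?_).add (IsPolyFun.const _)
  have h : ∀ x : FpPoint p d k, M.bil (FpPoint.block x q.1.1) (FpPoint.block x q.1.2) =
      ∑ l, M.bil (FpPoint.block x q.1.1) (Pi.single l 1) * x (q.1.2, l) := by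
    intro x
    conv_lhs => rw [pi_eq_sum_univ' (FpPoint.block x q.1.2)]
    rw [M.bil_sum_right]
    refine Finset.sum_congr rfl fun l _ => ?_
    rw [M.bil_smul_right, mul_comm]
    rfl
  simp only [h]
  exact IsPolyFun.sum _ fun l _ => (M.isPolyFun_block _ _).mul (IsPolyFun.coord _)

lemma FpQuadForm.isPolyFun_det_pairing :
    IsPolyFun k (fun x : FpPoint p d k => (M.pairing f x).det) :=
  IsPolyFun.det fun i j => M.isPolyFun_block i (f j)

/-- The complement of a chart is small. -/
lemma FpQuadForm.ncard_det_pairing_eq_zero_mul_le {e : FpPoint p d k}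
    (he : (M.pairing f e).det ≠ 0) :
    {x | (M.pairing f x).det = 0}.ncard * p ≤ k * p ^ (k * d) := by
  obtain ⟨P, hP, hPx⟩ := M.isPolyFun_det_pairing f
  have hne : P ≠ 0 := by
    rintro rfl
    exact he (by simpa using (hPx e).symm)
  have h := ncard_zeros_mul_le hne
  simp only [hPx, Fintype.card_prod, Fintype.card_fin] at h
  exact h.trans (Nat.mul_le_mul_right _ hP)

/-- Zeros in a chart: if many points of the chart are mapped into `residueZeros p (p ^ j) Q` by
an affine map `T`, then all of them are. -/
lemma FpQuadForm.chart_dichotomy (hp2 : p ≠ 2) (hf : ∀ i j, M.bil (f i) (f j) = 0)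
    {F : Fin r → MCoeff p d k} (hF : ∀ i, (F i).1.2 = 0)
    (hli : LinearIndependent (ZMod p) fun i => (F i).1.1)
    {T : FpPoint p d k → FpPoint p d k} {a : Fin k → Fin k → ZMod p} {t : FpPoint p d k}
    (hT : ∀ x q, T x q = (∑ i, a i q.1 * x (i, q.2)) + t q)
    {s : ℕ} (j : ℕ) {Q : MvPolynomial (Fin k × Fin d) ℤ} (hQ : Q.totalDegree ≤ s) :
    p ^ r * {z | z ∈ M.zeroSet F ∧ (M.pairing f z).det ≠ 0 ∧
        T z ∈ residueZeros p (p ^ j) Q}.ncard * p ≤ s * (k + 3) * p ^ (k * d) ∨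
      ∀ z ∈ M.zeroSet F, (M.pairing f z).det ≠ 0 → T z ∈ residueZeros p (p ^ j) Q := by
  obtain ⟨v, hv⟩ := hli.exists_dotProduct_eq
  set N : Fin k × Fin d → FpPoint p d k → ZMod p := fun q x =>
    (M.pairing f x).det * x q + ∑ l, (2⁻¹ * ∑ m,
      symMat (-∑ i, M.quadFun (F i) x • v i) q.1 m * (M.pairing f x).adjugate l m) * f l q.2
  set C : Fin k × Fin d → FpPoint p d k → ZMod p := fun q x =>
    (∑ i, a i q.1 * N (i, q.2) x) + t q * (M.pairing f x).det
  have hsym : ∀ i m, IsPolyFun 2 (fun x : FpPoint p d k =>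
      symMat (-∑ i, M.quadFun (F i) x • v i) i m) := by
    have h : ∀ q, IsPolyFun 2 (fun x : FpPoint p d k =>
        (-∑ i, M.quadFun (F i) x • v i) q) := by
      intro q
      simp only [Pi.neg_apply, Finset.sum_apply, Pi.smul_apply, smul_eq_mul]
      simpa only [neg_one_mul] using IsPolyFun.const_mul (-1) (IsPolyFun.sum Finset.univ fun i _ =>
        (M.isPolyFun_quadFun (hF i)).mul_const (v i q))
    intro i m
    by_cases him : i ≤ m
    · simpa [symMat, him] using h ⟨(i, m), him⟩
    · simpa [symMat, him] using h ⟨(m, i), (not_le.1 him).le⟩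
  have hN : ∀ q, IsPolyFun (k + 2) (N q) := by
    intro q
    refine (((M.isPolyFun_det_pairing f).mul (IsPolyFun.coord q)).mono (by omega)).add ?_
    refine IsPolyFun.sum _ fun l _ => ?_
    refine ((IsPolyFun.sum _ fun m _ => ?_).const_mul _).mul_const _
    exact ((hsym _ _).mul (IsPolyFun.adjugate (fun i j => M.isPolyFun_block i (f j)) _ _)).mono
      (by omega)
  have hC : ∀ q, IsPolyFun (k + 2) (C q) := fun q =>
    (IsPolyFun.sum _ fun i _ => (hN _).const_mul _).add
      (((M.isPolyFun_det_pairing f).mono (by omega)).const_mul _)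
  have hCT : ∀ x, (M.pairing f x).det ≠ 0 →
      (fun q => C q x / (M.pairing f x).det) = T (M.retract f F v x) := by
    intro x hx
    have hNx : ∀ q, N q x = M.retract f F v x q * (M.pairing f x).det := by
      intro q
      simp only [N, FpQuadForm.retract, FpQuadForm.gramShift, Pi.add_apply, add_mul, Matrix.mul_apply,
        Matrix.transpose_apply, Matrix.inv_def, Ring.inverse_eq_inv', Matrix.smul_apply, smul_eq_mul,
        Finset.sum_mul, Finset.mul_sum]
      congr 1
      · ring
      · refine Finset.sum_congr rfl fun l _ => Finset.sum_congr rfl fun m _ => ?_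
        field_simp
    funext q
    rw [div_eq_iff hx, hT]
    simp only [C, hNx, add_mul, Finset.sum_mul, mul_assoc]
  have hdich := rational_chart_dichotomy j hQ ((M.isPolyFun_det_pairing f).mono
    (Nat.le_add_right k 2)) hC
  refine hdich.imp (fun h => ?_) fun h z hz hdet => ?_
  · have hset : {x | (M.pairing f x).det ≠ 0 ∧
        (fun q => C q x / (M.pairing f x).det) ∈ residueZeros p (p ^ j) Q} =
        {x | (M.pairing f x).det ≠ 0 ∧ M.retract f F v x ∈ T ⁻¹' residueZeros p (p ^ j) Q} := by
      ext x
      refine and_congr_right fun hx => ?_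
      rw [hCT x hx]
      rfl
    rw [hset, M.ncard_retract_preimage hp2 hf hF hv, Fintype.card_prod, Fintype.card_fin,
      Fintype.card_fin] at h
    exact h
  · have := h z hdet
    rwa [hCT z hdet, M.retract_eq_self v hz] at this

/-- The exact number of points of the zero set in a chart. -/
lemma FpQuadForm.ncard_zeroSet_inter_chart (hp2 : p ≠ 2) (hf : ∀ i j, M.bil (f i) (f j) = 0)
    {F : Fin r → MCoeff p d k} (hF : ∀ i, (F i).1.2 = 0)
    (hli : LinearIndependent (ZMod p) fun i => (F i).1.1) :
    p ^ r * {z | z ∈ M.zeroSet F ∧ (M.pairing f z).det ≠ 0}.ncard =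
      {x | (M.pairing f x).det ≠ 0}.ncard := by
  obtain ⟨v, hv⟩ := hli.exists_dotProduct_eq
  simpa using (M.ncard_retract_preimage hp2 hf hF hv Set.univ).symm

end ChartPolynomials

/-! ### Irreducibility of sets with prescribed Gram matrix -/

section GramSets

variable {p d k r : ℕ} [Fact p.Prime] {M : FpQuadForm p d}

/-- A set cut out by `r` independent conditions on the Gram matrix is irreducible if `2 r < d`: the
zeros of a polynomial fill a chart as soon as they are dense, because a chart has almost as many
points as the whole set, and lines lead from the charts to all other points. -/
lemma FpQuadForm.Nondegenerate.isResidueIrreducible_image (hM : M.Nondegenerate) (hk : 0 < k)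
    (hkd : 4 * k - 1 ≤ d) (hrd : 2 * r + 1 ≤ d) {F : Fin r → MCoeff p d k}
    (hF : ∀ i, (F i).1.2 = 0) (hli : LinearIndependent (ZMod p) fun i => (F i).1.1)
    {T : FpPoint p d k → FpPoint p d k} {a : Fin k → Fin k → ZMod p} {t : FpPoint p d k}
    (hT : ∀ x q, T x q = (∑ i, a i q.1 * x (i, q.2)) + t q) (hTinj : Function.Injective T)
    {δ : ℝ} {s : ℕ} (hp2 : p ≠ 2) (hpk : 2 * k ≤ p) (hps : s + k < p)
    (hδ : 2 * (1 + k + s * (k + 3) : ℝ) ≤ √p * δ) :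
    IsResidueIrreducible δ s (T '' M.zeroSet F) := by
  intro j Q hQ
  rw [or_iff_not_imp_left, not_le]
  intro hlarge
  have hp : (0 : ℝ) < p := by exact_mod_cast (Fact.out : p.Prime).pos
  have hp1 : (1 : ℝ) ≤ p := by exact_mod_cast (Fact.out : p.Prime).one_lt.le
  set Z := M.zeroSet F
  set R : Set (FpPoint p d k) := residueZeros p (p ^ j) Q
  have hind : IsIndependentFamily F :=
    LinearIndependent.of_comp (LinearMap.fst (ZMod p) _ _) hli
  set n : ℝ := (p : ℝ) ^ (k * d) with hn
  set q : ℝ := √p with hq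
  have hn0 : 0 < n := pow_pos hp _
  have hq1 : 1 ≤ q := Real.one_le_sqrt.2 hp1
  have hq0 : 0 < q := by linarith
  have hqp : q ^ 2 = p := Real.sq_sqrt hp.le
  have hpr : (0 : ℝ) < (p : ℝ) ^ r := pow_pos hp r
  -- `|Z| ≤ (1 + p ^ (-1/2)) p ^ (k d - r)`
  have hZ : (p : ℝ) ^ r * Z.ncard * q ≤ n * q + n := by
    have h1 := (abs_le.1 (hM.abs_ncard_zeroSet_sub_le hp2 hind)).2
    have h2 : (p : ℝ) ^ r * q ≤ q ^ d := by
      calc (p : ℝ) ^ r * q = q ^ (2 * r + 1) := by rw [pow_succ, pow_mul, hqp]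
        _ ≤ q ^ d := pow_le_pow_right₀ hq1 hrd
    have h3 : n / q ^ d ≤ n / ((p : ℝ) ^ r * q) :=
      div_le_div_of_nonneg_left hn0.le (by positivity) h2
    have h4 : (Z.ncard : ℝ) ≤ n / (p : ℝ) ^ r + n / ((p : ℝ) ^ r * q) := by linarith
    calc (p : ℝ) ^ r * Z.ncard * q
        ≤ (p : ℝ) ^ r * (n / (p : ℝ) ^ r + n / ((p : ℝ) ^ r * q)) * q := by gcongr
      _ = n * q + n := by field_simp
  have hcharts : ∀ f : Fin k → Fin d → ZMod p, (∀ i j, M.bil (f i) (f j) = 0) →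
      (∃ e, (M.pairing f e).det ≠ 0) →
      ∀ z ∈ Z, (M.pairing f z).det ≠ 0 → T z ∈ R := by
    rintro f hf ⟨e, he⟩
    refine (M.chart_dichotomy f hp2 hf hF hli hT j hQ).resolve_left fun hsmall => ?_
    set A := {z | z ∈ Z ∧ (M.pairing f z).det ≠ 0 ∧ T z ∈ R}
    set U := {z | z ∈ Z ∧ (M.pairing f z).det ≠ 0}
    have hU : p ^ r * U.ncard = {x | (M.pairing f x).det ≠ 0}.ncard :=
      M.ncard_zeroSet_inter_chart f hp2 hf hF hli
    have hc := M.ncard_det_pairing_eq_zero_mul_le f he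
    have hcompl : {x | (M.pairing f x).det ≠ 0}.ncard + {x | (M.pairing f x).det = 0}.ncard =
        p ^ (k * d) := by
      have h1 : {x | (M.pairing f x).det ≠ 0} = {x | (M.pairing f x).det = 0}ᶜ := rfl
      rw [h1, add_comm, Set.ncard_add_ncard_compl, Nat.card_eq_fintype_card, card_fpPoint]
    have hUZ : U.ncard + (Z \ U).ncard = Z.ncard := by
      rw [add_comm]
      exact Set.ncard_sdiff_add_ncard_of_subset (fun z hz => hz.1) (Set.toFinite _)
    have hA : (R ∩ T '' Z).ncard ≤ A.ncard + (Z \ U).ncard := by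
      have h1 : R ∩ T '' Z ⊆ T '' (A ∪ Z \ U) := by
        rintro _ ⟨hR, z, hz, rfl⟩
        refine ⟨z, ?_, rfl⟩
        by_cases hdet : (M.pairing f z).det = 0
        · exact Or.inr ⟨hz, fun h => h.2 hdet⟩
        · exact Or.inl ⟨hz, hdet, hR⟩
      calc _ ≤ (T '' (A ∪ Z \ U)).ncard := Set.ncard_le_ncard h1 (Set.toFinite _)
        _ ≤ (A ∪ Z \ U).ncard := Set.ncard_image_le (Set.toFinite _)
        _ ≤ _ := Set.ncard_union_le _ _
    rw [Set.ncard_image_of_injective _ hTinj] at hlarge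
    have hsmall' : (p : ℝ) ^ r * A.ncard * p ≤ s * (k + 3) * n := by rw [hn]; exact_mod_cast hsmall
    have hU' : (p : ℝ) ^ r * U.ncard * p ≥ n * p - k * n := by
      have h1 : (p : ℝ) ^ r * U.ncard = n - {x | (M.pairing f x).det = 0}.ncard := by
        rw [eq_sub_iff_add_eq, hn]
        exact_mod_cast hU ▸ hcompl
      have h2 : ({x | (M.pairing f x).det = 0}.ncard : ℝ) * p ≤ k * n := by
        rw [hn]; exact_mod_cast hc
      rw [h1]
      linarith
    have hUZ' : (U.ncard : ℝ) + (Z \ U).ncard = Z.ncard := by exact_mod_cast hUZ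
    have hA' : δ * Z.ncard < A.ncard + (Z \ U).ncard :=
      hlarge.trans_le (by exact_mod_cast hA)
    have hδ0 : 0 < δ := by
      have h1 : 0 < q * δ := lt_of_lt_of_le (by positivity) hδ
      exact pos_of_mul_pos_right h1 hq0.le
    -- multiply the density inequality by `p ^ r * p`
    have h1 : δ * ((p : ℝ) ^ r * Z.ncard * p) <
        s * (k + 3) * n + (p : ℝ) ^ r * Z.ncard * p - (n * p - k * n) := by
      have h2 : (p : ℝ) ^ r * p * (δ * Z.ncard) < (p : ℝ) ^ r * p * (A.ncard + (Z \ U).ncard) :=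
        mul_lt_mul_of_pos_left hA' (by positivity)
      have h3 : (p : ℝ) ^ r * p * ((U.ncard : ℝ) + (Z \ U).ncard) = (p : ℝ) ^ r * p * Z.ncard := by
        rw [hUZ']
      linarith
    have h4 : n * p - k * n ≤ (p : ℝ) ^ r * Z.ncard * p := by
      have h5 : (U.ncard : ℝ) ≤ Z.ncard := by
        have := Nat.cast_nonneg (α := ℝ) (Z \ U).ncard
        linarith
      refine hU'.trans ?_
      gcongr
    have h6 : (p : ℝ) ^ r * Z.ncard * p ≤ n * p + n * q := by
      have := mul_le_mul_of_nonneg_right hZ hq0.le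
      have h7 : (p : ℝ) ^ r * Z.ncard * q * q = (p : ℝ) ^ r * Z.ncard * p := by rw [← hqp]; ring
      have h8 : (n * q + n) * q = n * p + n * q := by rw [← hqp]; ring
      linarith
    have h9 : n * p / 2 ≤ n * p - k * n := by
      have : (2 * k : ℝ) ≤ p := by exact_mod_cast hpk
      nlinarith
    have h10 : δ * (n * p / 2) < n * (s * (k + 3) + k + q) := by
      have := mul_le_mul_of_nonneg_left (h9.trans h4) hδ0.le
      linarith
    have h11 : δ * p < 2 * (s * (k + 3) + k + q) := by
      have : n * (δ * p / 2) < n * (s * (k + 3) + k + q) := by linarith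
      have := lt_of_mul_lt_mul_left this hn0.le
      linarith
    have h12 : (q * δ) * q = δ * p := by rw [← hqp]; ring
    have h13 : 2 * (1 + k + s * (k + 3) : ℝ) * q ≤ δ * p := by
      rw [← h12]; gcongr
    have h14 : (0 : ℝ) ≤ (k + s * (k + 3) : ℝ) * (q - 1) :=
      mul_nonneg (by positivity) (by linarith)
    linarith
  rintro _ ⟨z, hz, rfl⟩
  obtain ⟨f, y, hf, hyy, hyz, hcard⟩ := hM.exists_line hp2 hk hkd z
  classical
  set good : Finset (ZMod p) :=
    Finset.univ.filter fun c => (M.pairing f (z + c • y)).det ≠ 0 with hgood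
  have hgoodcard : s < good.card := by
    have h1 := Finset.card_filter_add_card_filter_not (s := (Finset.univ : Finset (ZMod p)))
      (fun c : ZMod p => (M.pairing f (z + c • y)).det = 0)
    have h2 : {c : ZMod p | (M.pairing f (z + c • y)).det = 0}.ncard =
        (Finset.univ.filter fun c : ZMod p => (M.pairing f (z + c • y)).det = 0).card := by
      rw [← Set.ncard_coe_finset]
      simp
    rw [Finset.card_univ, ZMod.card, ← h2] at h1
    have h3 : good.card = (Finset.univ.filter
      fun c : ZMod p => ¬ (M.pairing f (z + c • y)).det = 0).card := rfl
    omega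
  obtain ⟨c₀, hc₀⟩ := Finset.card_pos.1 ((Nat.zero_le s).trans_lt hgoodcard)
  have hf' := hcharts f hf ⟨_, (Finset.mem_filter.1 hc₀).2⟩
  refine mem_residueZeros_of_line j hQ (T z) (fun q => ∑ i, a i q.1 * y (i, q.2)) good hgoodcard
    fun c hc => ?_
  have hTc : T z + c • (fun q => ∑ i, a i q.1 * y (i, q.2)) = T (z + c • y) := by
    funext q
    simp only [Pi.add_apply, Pi.smul_apply, smul_eq_mul, hT, mul_add, Finset.sum_add_distrib,
      Finset.mul_sum, mul_left_comm]
    ring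
  rw [hTc]
  refine hf' _ (fun i => ?_) (Finset.mem_filter.1 hc).2
  have hbl : ∀ i, FpPoint.block (z + c • y) i = FpPoint.block z i + c • FpPoint.block y i :=
    fun i => rfl
  rw [← hz i]
  simp only [M.quadFun_eq, hF, hbl, M.bil_add_left, M.bil_add_right, M.bil_smul_left,
    M.bil_smul_right, hyy, hyz, M.bil_comm (FpPoint.block z _) (FpPoint.block y _)]
  simp

end GramSets

/-! ### Nice sets -/

section Nice

variable {p d k : ℕ} {M : FpQuadForm p d}

/-- A nice function is an affine function of the Gram matrix. -/
lemma FpQuadForm.IsNiceFun.exists_coeff {g : FpPoint p d k → ZMod p} (hg : M.IsNiceFun g) :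
    ∃ G : MCoeff p d k, G.1.2 = 0 ∧ ∀ n, g n = M.quadFun G n := by
  rcases hg with ⟨u, hu⟩ | ⟨k', b, u, hg⟩
  · exact ⟨((0, 0), u), rfl, fun n => by simp [hu, M.quadFun_eq]⟩
  · refine ⟨((fun q => if q.1.2 = k' then b q.1.1 else 0, 0), u), rfl, fun n => ?_⟩
    rw [hg, M.quadFun_eq]
    simp only [ite_mul, zero_mul, Pi.zero_apply, zero_dotProduct, Finset.sum_const_zero, add_zero]
    congr 1
    rw [← Finset.sum_filter]
    symm
    refine Finset.sum_bij (fun q _ => q.1.1) ?_ ?_ ?_ ?_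
    · intro q hq
      rw [Finset.mem_filter] at hq ⊢
      exact ⟨Finset.mem_univ _, hq.2 ▸ q.2⟩
    · intro q hq q' hq' h
      rw [Finset.mem_filter] at hq hq'
      exact Subtype.ext (Prod.ext h (hq.2.trans hq'.2.symm))
    · intro i hi
      exact ⟨⟨(i, k'), (Finset.mem_filter.1 hi).2⟩, by simp, rfl⟩
    · intro q hq
      rw [(Finset.mem_filter.1 hq).2, M.bil_comm]
      rfl

variable [Fact p.Prime]

/-- A non-empty zero set is cut out by an independent subfamily. -/
lemma FpQuadForm.exists_independent_subfamily {r : ℕ} {G : Fin r → MCoeff p d k}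
    (hG : ∀ i, (G i).1.2 = 0) (hne : (M.zeroSet G).Nonempty) :
    ∃ (m : ℕ) (F : Fin m → MCoeff p d k), (∀ i, (F i).1.2 = 0) ∧
      LinearIndependent (ZMod p) (fun i => (F i).1.1) ∧ M.zeroSet F = M.zeroSet G := by
  obtain ⟨κ, a, ha, hspan, hli⟩ := exists_linearIndependent' (ZMod p) (fun i => (G i).1.1)
  have : Finite κ := Finite.of_injective a ha
  obtain ⟨m, ⟨e⟩⟩ := Finite.exists_equiv_fin κ
  refine ⟨m, fun i => G (a (e.symm i)), fun i => hG _, hli.comp e.symm e.symm.injective, ?_⟩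
  obtain ⟨x₀, hx₀⟩ := hne
  -- the values at `x` and `x₀` differ by a linear function of the coefficients
  have hlin : ∀ (x : FpPoint p d k) (i : Fin r), M.quadFun (G i) x =
      (G i).1.1 ⬝ᵥ (fun q => M.bil (FpPoint.block x q.1.1) (FpPoint.block x q.1.2) -
        M.bil (FpPoint.block x₀ q.1.1) (FpPoint.block x₀ q.1.2)) := by
    intro x i
    have h0 : M.quadFun (G i) x = M.quadFun (G i) x - M.quadFun (G i) x₀ := by
      rw [hx₀ i, sub_zero]
    rw [h0]
    simp only [M.quadFun_eq, hG, dotProduct, mul_sub, Finset.sum_sub_distrib, Pi.zero_apply,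
      zero_mul, Finset.sum_const_zero]
    ring
  ext x
  refine ⟨fun hx i => ?_, fun hx i => hx _⟩
  have hmem : (G i).1.1 ∈ Submodule.span (ZMod p) (Set.range ((fun i => (G i).1.1) ∘ a)) := by
    rw [hspan]
    exact Submodule.subset_span ⟨i, rfl⟩
  rw [hlin]
  generalize (G i).1.1 = w at hmem ⊢
  induction hmem using Submodule.span_induction with
  | mem w hw =>
    obtain ⟨l, rfl⟩ := hw
    have := hx (e l)
    simp only [Equiv.symm_apply_apply, hlin] at this
    exact this
  | zero => exact zero_dotProduct _
  | add w w' _ _ hw hw' => rw [add_dotProduct, hw, hw', add_zero]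
  | smul c w _ hw => rw [smul_dotProduct, hw, smul_zero]

/-- An independent family of `r` members with `2 r < d` has a common zero, and a longer independent
family has fewer zeros: already `r + 1` of its members have too few. -/
lemma FpQuadForm.Nondegenerate.card_le_of_ncard_zeroSet_eq (hM : M.Nondegenerate) (hp : 9 ≤ p)
    {r m : ℕ} (hr : 2 * r + 1 ≤ d) {G : Fin r → MCoeff p d k} (hG : IsIndependentFamily G) :
    (M.zeroSet G).Nonempty ∧ ∀ F : Fin m → MCoeff p d k, IsIndependentFamily F →
      (M.zeroSet F).ncard = (M.zeroSet G).ncard → m ≤ r := by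
  have hp2 : p ≠ 2 := by omega
  have hp9 : (9 : ℝ) ≤ p := by exact_mod_cast hp
  have hp0 : (0 : ℝ) < p := by linarith
  set n : ℝ := (p : ℝ) ^ (k * d)
  have hn0 : 0 < n := pow_pos hp0 _
  set q : ℝ := √p
  have hqp : q ^ 2 = p := Real.sq_sqrt hp0.le
  have hq3 : 3 ≤ q := Real.le_sqrt_of_sq_le (by linarith)
  have hpr : (0 : ℝ) < (p : ℝ) ^ r := pow_pos hp0 r
  have hE : n / q ^ d ≤ n / (p : ℝ) ^ r / 3 := by
    rw [div_div]
    refine div_le_div_of_nonneg_left hn0.le (by positivity) ?_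
    calc (p : ℝ) ^ r * 3 ≤ (p : ℝ) ^ r * q := by gcongr
      _ = q ^ (2 * r + 1) := by rw [pow_succ, pow_mul, hqp]
      _ ≤ q ^ d := pow_le_pow_right₀ (by linarith) hr
  have hN : 0 < n / (p : ℝ) ^ r := by positivity
  have hlow := (abs_le.1 (hM.abs_ncard_zeroSet_sub_le hp2 hG)).1
  refine ⟨?_, fun F hF hcard => ?_⟩
  · rw [← Set.ncard_pos (Set.toFinite _)]
    have : (0 : ℝ) < (M.zeroSet G).ncard := by linarith
    exact_mod_cast this
  by_contra! hlt
  have hF' : IsIndependentFamily (fun i : Fin (r + 1) => F (Fin.castLE hlt i)) :=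
    hF.comp _ (Fin.castLE_injective hlt)
  have hup := (abs_le.1 (hM.abs_ncard_zeroSet_sub_le hp2 hF')).2
  have hsub : (M.zeroSet F).ncard ≤
      (M.zeroSet (fun i : Fin (r + 1) => F (Fin.castLE hlt i))).ncard :=
    Set.ncard_le_ncard (fun x hx i => hx _) (Set.toFinite _)
  have hsub' : ((M.zeroSet G).ncard : ℝ) ≤
      (M.zeroSet (fun i : Fin (r + 1) => F (Fin.castLE hlt i))).ncard := by
    rw [← hcard]; exact_mod_cast hsub
  have h9 : n / (p : ℝ) ^ (r + 1) ≤ n / (p : ℝ) ^ r / 9 := by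
    rw [div_div, pow_succ]
    exact div_le_div_of_nonneg_left hn0.le (by positivity) (by gcongr)
  linarith

/-- The irreducibility of nice sets, with an explicit dependence of `p` on `δ`. -/
lemma FpQuadForm.Nondegenerate.isResidueIrreducible_of_isNiceSet (hM : M.Nondegenerate) (hk : 0 < k)
    {Ω : Set (FpPoint p d k)} (hnice : M.IsNiceSet Ω) (hcons : M.IsConsistentSet Ω)
    (hd : max (2 * M.totalCodim Ω + 1) (4 * k - 1) ≤ d) {δ : ℝ} {s : ℕ} (hp9 : 9 ≤ p)
    (hpk : 2 * k ≤ p) (hps : s + k < p) (hδ : 2 * (1 + k + s * (k + 3) : ℝ) ≤ √p * δ) :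
    IsResidueIrreducible δ s Ω := by
  obtain ⟨hd1, hd2⟩ := max_le_iff.1 hd
  obtain ⟨G₀, hG₀, hΩ₀⟩ : M.HasIndependentRep Ω (M.totalCodim Ω) :=
    Nat.sInf_mem (M.exists_hasIndependentRep hcons)
  obtain ⟨r, F₀, ⟨L, ⟨a, ha⟩, hL, v, hF₀⟩, hΩ⟩ := hnice
  choose G hG hGF using fun i => (hF₀ i).exists_coeff
  set T : FpPoint p d k → FpPoint p d k := fun x => L x + v
  have hTinj : Function.Injective T := fun x y h => hL.1 (add_right_cancel h)
  have hT : ∀ x q, T x q = (∑ i, a i q.1 * x (i, q.2)) + v q := by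
    rintro x ⟨j, l⟩
    have := congrFun (ha x j) l
    simp only [Finset.sum_apply, Pi.smul_apply, smul_eq_mul, FpPoint.block] at this
    simp only [T, Pi.add_apply, this]
  have himage : Ω = T '' M.zeroSet G := by
    rw [hΩ]
    ext y
    constructor
    · intro hy
      obtain ⟨x, hx⟩ := hL.2 (y - v)
      have hxy : T x = y := by simp [T, hx]
      exact ⟨x, fun i => by rw [← hGF]; exact (congrArg (M.quadFun (F₀ i)) hxy).trans (hy i), hxy⟩
    · rintro ⟨x, hx, rfl⟩ i
      exact (hGF i x).trans (hx i)
  have hcompare := fun m => hM.card_le_of_ncard_zeroSet_eq (m := m) hp9 hd1 hG₀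
  have hne : (M.zeroSet G).Nonempty := by
    have := (hcompare 0).1
    rw [← hΩ₀, himage] at this
    exact this.of_image
  obtain ⟨m, F, hF, hli, hFG⟩ := M.exists_independent_subfamily hG hne
  have hmr : m ≤ M.totalCodim Ω := by
    refine (hcompare m).2 F (LinearIndependent.of_comp (LinearMap.fst (ZMod p) _ _) hli) ?_
    rw [← hΩ₀, hFG]
    conv_rhs => rw [himage]
    rw [Set.ncard_image_of_injective _ hTinj]
  rw [himage, ← hFG]
  exact hM.isResidueIrreducible_image hk hd2 (by omega) hF hli hT hTinj (by omega) hpk hps hδ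

end Nice

theorem theorem1 (d s : ℕ) (hd : 0 < d) :
    ∃ C₁ C₂ : ℝ, 0 < C₁ ∧ 0 < C₂ ∧
      ∀ (K : ℕ), 0 < K → ∀ (p : ℕ) [Fact p.Prime] (δ : ℝ), 0 < δ →
      ∀ M : FpQuadForm p d, M.Nondegenerate →
      ∀ Ω : Set (FpPoint p d K), M.IsNiceSet Ω → M.IsConsistentSet Ω →
        max (2 * M.totalCodim Ω + 1) (4 * K - 1) ≤ d →
        C₁ * δ ^ (-C₂) ≤ (p : ℝ) →
          IsDeltaIrreducible δ s Ω ∧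
          IsWeaklyIrreducible δ p s (tauMap '' Ω) ∧
          IsStronglyIrreducible δ p s (tauMap '' Ω) := by
  set m : ℝ := 9 + 2 * (1 + d + s * (d + 3)) with hm
  have hm9 : 9 ≤ m := by
    have : (0 : ℝ) ≤ 2 * (1 + d + s * (d + 3)) := by positivity
    linarith
  refine ⟨m ^ 2, 2, by positivity, two_pos, ?_⟩
  intro K hK p _ δ hδ M hM Ω hnice hcons hmax hC
  have hp := (Fact.out : p.Prime)
  rcases le_or_gt 1 δ with h1 | h1
  · -- for `δ ≥ 1` the first alternative always holds
    have htriv : ∀ {α : Type} (A B : Set α), B.Finite → ((A ∩ B).ncard : ℝ) ≤ δ * B.ncard := by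
      intro α A B hB
      have h2 : ((A ∩ B).ncard : ℝ) ≤ B.ncard := by
        exact_mod_cast Set.ncard_le_ncard Set.inter_subset_right hB
      exact h2.trans (le_mul_of_one_le_left (Nat.cast_nonneg _) h1)
    have hfin : (reduceMod p (tauMap '' Ω)).Finite := by
      rw [reduceMod_tauMap_image]
      exact (Set.toFinite Ω).image _
    exact ⟨fun P _ => Or.inl (htriv _ _ (Set.toFinite _)), fun P _ _ => Or.inl (htriv _ _ hfin),
      fun P _ _ => Or.inl (htriv _ _ hfin)⟩
  have hKd : K ≤ d := by
    have := (max_le_iff.1 hmax).2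
    omega
  have hKd' : (K : ℝ) ≤ d := by exact_mod_cast hKd
  have hsqrt : m ≤ √p * δ := by
    rw [← div_le_iff₀ hδ]
    refine Real.le_sqrt_of_sq_le ?_
    rw [div_pow]
    rw [Real.rpow_neg hδ.le, Real.rpow_two] at hC
    exact hC
  have hmp : m ^ 2 ≤ (p : ℝ) := by
    have h2 : m ≤ √p := hsqrt.trans (mul_le_of_le_one_right (Real.sqrt_nonneg _) h1.le)
    calc m ^ 2 ≤ √p ^ 2 := by gcongr
      _ = (p : ℝ) := Real.sq_sqrt (Nat.cast_nonneg p)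
  have hmp' : 9 * m ≤ p := by nlinarith
  have hsd : (0 : ℝ) ≤ s * d := by positivity
  have hp9 : 9 ≤ p := by
    have : (9 : ℝ) ≤ p := by linarith
    exact_mod_cast this
  have hpK : 2 * K ≤ p := by
    have : (2 * K : ℝ) ≤ p := by linarith [(Nat.cast_nonneg s : (0 : ℝ) ≤ s)]
    exact_mod_cast this
  have hps : s + K < p := by
    have : (s + K : ℝ) < p := by linarith [(Nat.cast_nonneg s : (0 : ℝ) ≤ s)]
    exact_mod_cast this
  have hirr : IsResidueIrreducible δ s Ω := by
    refine hM.isResidueIrreducible_of_isNiceSet hK hnice hcons hmax hp9 hpK hps (le_trans ?_ hsqrt)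
    have h3 : (s : ℝ) * (K + 3) ≤ s * (d + 3) := by gcongr
    linarith
  exact ⟨hirr.isDeltaIrreducible,
    fun P hP hval => hirr.real_dichotomy (j := 1) (by omega) P hP (by rwa [pow_one]),
    fun P hP hval => hirr.real_dichotomy (by omega) P hP hval⟩
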